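/- Let $\Bbbk$ be a commutative integral domain and let $m,n\ge 0$ be integers. A weight in $\mathscr P_{m,n}$ is a labelling of the $m+n$ points $-m+\tfrac12,\dots,n-\tfrac12$ by $\wedge$ and $\vee$ with exactly $m$ labels $\wedge$. The cup diagram $\underline\mu$ of a weight $\mu$ is obtained by repeatedly joining by a cup two not yet joined vertices labelled $\vee,\wedge$ (from left to right) that have only already joined vertices between them, and by drawing rays at the remaining vertices; $\overline\mu$ is its mirror image. The diagram $\underline\mu\lambda$ (equivalently $\lambda\overline\mu$) is oriented if $\lambda$ labels the two ends of each cup of $\underline\mu$ by one $\vee$ and one $\wedge$ and no two rays are labelled $\vee,\wedge$ from left to right. The extended Khovanov arc algebra $\mathcal K_{m,n}$ is the $\Bbbk$-algebra that is free as a $\Bbbk$-module on the arc diagrams $\underline\mu\lambda\overline\nu$ with $\lambda,\mu,\nu\in\mathscr P_{m,n}$ such that $\underline\mu\lambda$ and $\lambda\overline\nu$ are oriented, graded by letting $\deg(\underline\mu\lambda\overline\nu)$ be the number of clockwise (that is, $\wedge\vee$-labelled) cups and caps. The product $(\underline\lambda\mu\overline\nu)(\underline\alpha\beta\overline\gamma)$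 is $0$ unless $\nu=\alpha$. If $\nu=\alpha$, place the first diagram under the second, join the rays of $\overline\nu$ and $\underline\nu$, replace successively (outer pairs before the pairs they enclose) each cap of $\overline\nu$ and the mirror-image cup of $\underline\nu$ by two vertical segments, and finally identify the two weight lines. At each step the components involved are re-oriented by the following rules, where $1$ is an anti-clockwise circle, $x$ a clockwise circle and $y$ an oriented strand (whose ends keep their orientation): $$1\mapsto 1\otimes x+x\otimes 1,\quad x\mapsto x\otimes x,\quad y\mapsto x\otimes y,$$ $$1\otimes1\mapsto1,\quad 1\otimes x\mapsto x,\quad x\otimes 1\mapsto x,\quad x\otimes x\mapsto 0,\quad 1\otimes y\mapsto y,\quad x\otimes y\mapsto 0,$$ and $y\otimes y\mapsto y\otimes y$ if both strands are propagating (run from bottom to top), one being $\wedge$-oriented and the other $\vee$-oriented, and $y\otimes y\mapsto 0$ otherwise. For an integer $k$ with $-m\le k\le n$ let $\varphi_k:\mathscr P_{m,n}\to\mathscr P_{m+1,n+1}$ be the dilation map, which moves each label in a position $x<k$ to $x-1$ and each label in a position $x>k$ to $x+1$, and labels the vertices $k-\tfrac12$ and $k+\tfrac12$ by $\vee$ and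 $\wedge$ respectively. **Theorem.** For every integer $k$ with $-m\le k\le n$, the map defined on arc diagrams by $$\varphi_k(\underline\mu\lambda\overline\nu)=\underline{\varphi_k(\mu)}\,\varphi_k(\lambda)\,\overline{\varphi_k(\nu)}$$ (which sends arc diagrams to arc diagrams) extends to an injective, degree-preserving homomorphism of graded $\Bbbk$-algebras $\varphi_k:\mathcal K_{m,n}\to\mathcal K_{m+1,n+1}$; the homomorphism is not required to preserve the identity element. -/

import Mathlib

/-! Extended Khovanov arc algebras and the dilation maps on weights. -/

namespace ArcAlgebra

/-- The two possible labels of a vertex: `up` is `∧` and `down` is `∨`. -/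
inductive Label
  | up
  | down
  deriving DecidableEq

instance : Fintype Label := ⟨{Label.up, Label.down}, fun l => by cases l <;> simp⟩

/-! ### Weights and dilation -/

/-- The weights in `𝒫_{m,n}`: a strip of `m + n` points, each labelled by `∧` or `∨`, with exactly
`m` labels `∧` (hence `n` labels `∨`).  The index `i : Fin (m + n)` stands for the point at the
half-integer position `i - m + 1/2`, so that the points are at `-m + 1/2, …, n - 1/2`. -/
abbrev Weight (m n : ℕ) : Type :=
  {a : Fin (m + n) → Label // (Finset.univ.filter fun i => a i = Label.up).card = m}

/-- The labels of the dilated weight `φ_k(a)`.  The vertex with index `i` of the new strip has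
position `i - (m + 1) + 1/2`.  The new vertices `k - 1/2` and `k + 1/2` have index `k + m` and
`k + m + 1`, and are labelled `∨` and `∧`; the label in an old position `x < k` is moved to
`x - 1` (the index stays the same), and that in an old position `x > k` is moved to `x + 1`
(the index grows by `2`). -/
def dilateLabels {m n : ℕ} (k : ℤ) (hk : -(m : ℤ) ≤ k) (hk' : k ≤ (n : ℤ))
    (a : Fin (m + n) → Label) (i : Fin ((m + 1) + (n + 1))) : Label :=
  if h : ((i : ℕ) : ℤ) < k + m then a ⟨i, by omega⟩
  else if h' : ((i : ℕ) : ℤ) = k + m then Label.down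
  else if h'' : ((i : ℕ) : ℤ) = k + m + 1 then Label.up
  else a ⟨i - 2, by omega⟩

theorem card_up_dilateLabels {m n : ℕ} (k : ℤ) (hk : -(m : ℤ) ≤ k) (hk' : k ≤ (n : ℤ))
    (a : Weight m n) :
    (Finset.univ.filter fun i => dilateLabels k hk hk' a.1 i = Label.up).card = m + 1 := by
  classical
  let e : Fin (m + n) → Fin ((m + 1) + (n + 1)) := fun i =>
    if ((i : ℕ) : ℤ) < k + m then ⟨i, by omega⟩ else ⟨i + 2, by omega⟩
  let c : Fin ((m + 1) + (n + 1)) := ⟨(k + m).toNat + 1, by omega⟩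
  have he : Function.Injective e := by
    intro i j hij
    simp only [e] at hij
    split_ifs at hij <;> simp only [Fin.mk.injEq] at hij <;> apply Fin.ext <;> omega
  have hae : ∀ i, dilateLabels k hk hk' a.1 (e i) = a.1 i := by
    intro i
    by_cases hi : ((i : ℕ) : ℤ) < k + m
    · simp [dilateLabels, e, hi]
    · have h1 : ¬ (((i + 2 : ℕ)) : ℤ) < k + m := by omega
      have h2 : ¬ (((i + 2 : ℕ)) : ℤ) = k + m := by omega
      have h3 : ¬ (((i + 2 : ℕ)) : ℤ) = k + m + 1 := by omega
      simp only [e, hi, if_false, dilateLabels]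
      rw [dif_neg h1, dif_neg h2, dif_neg h3]
      rfl
  have key : (Finset.univ.filter fun i => dilateLabels k hk hk' a.1 i = Label.up)
      = insert c ((Finset.univ.filter fun i => a.1 i = Label.up).image e) := by
    ext i
    simp only [Finset.mem_filter, Finset.mem_univ, true_and, Finset.mem_insert, Finset.mem_image]
    constructor
    · intro h
      by_cases h1 : ((i : ℕ) : ℤ) < k + m
      · right
        refine ⟨⟨i, by omega⟩, ?_, ?_⟩
        · simpa [dilateLabels, h1] using h
        · simp [e, h1]
      · by_cases h2 : ((i : ℕ) : ℤ) = k + m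
        · simp [dilateLabels, h2] at h
        · by_cases h3 : ((i : ℕ) : ℤ) = k + m + 1
          · left
            apply Fin.ext
            simp only [c]
            omega
          · right
            have h4 : ¬ (((i - 2 : ℕ)) : ℤ) < k + m := by omega
            refine ⟨⟨i - 2, by omega⟩, ?_, ?_⟩
            · simpa [dilateLabels, h1, h2, h3] using h
            · simp only [e]
              rw [if_neg h4]
              apply Fin.ext
              simp only
              omega
    · rintro (rfl | ⟨j, hj, rfl⟩)
      · have h1 : ¬ ((((k + m).toNat + 1 : ℕ)) : ℤ) < k + m := by omega
        have h2 : ¬ ((((k + m).toNat + 1 : ℕ)) : ℤ) = k + m := by omega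
        have h3 : ((((k + m).toNat + 1 : ℕ)) : ℤ) = k + m + 1 := by omega
        simp only [dilateLabels, c]
        rw [dif_neg h1, dif_neg h2, dif_pos h3]
      · rw [hae, hj]
  have hc : c ∉ (Finset.univ.filter fun i => a.1 i = Label.up).image e := by
    simp only [Finset.mem_image, not_exists, not_and]
    intro j _ h
    simp only [e, c] at h
    split_ifs at h <;> simp only [Fin.mk.injEq] at h <;> omega
  rw [key, Finset.card_insert_of_notMem hc, Finset.card_image_of_injective _ he, a.2]

/-- The dilation map `φ_k : 𝒫_{m,n} → 𝒫_{m+1,n+1}` on weights, for `-m ≤ k ≤ n`. -/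
def dilate {m n : ℕ} (k : ℤ) (hk : -(m : ℤ) ≤ k) (hk' : k ≤ (n : ℤ)) (a : Weight m n) :
    Weight (m + 1) (n + 1) :=
  ⟨dilateLabels k hk hk' a.1, card_up_dilateLabels k hk hk' a⟩

/-! ### Cup diagrams, oriented diagrams and degrees -/

/-- The vertex `i` is not an endpoint of one of the arcs in `C`. -/
def IsFree {N : ℕ} (C : Finset (Fin N × Fin N)) (i : Fin N) : Prop :=
  ∀ p ∈ C, p.1 ≠ i ∧ p.2 ≠ i

instance {N : ℕ} (C : Finset (Fin N × Fin N)) (i : Fin N) : Decidable (IsFree C i) :=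
  inferInstanceAs (Decidable (∀ p ∈ C, p.1 ≠ i ∧ p.2 ≠ i))

/-- The cups drawn after `t` rounds.  In each round, all pairs `∨ ∧` (from left to right) of
vertices that are not yet joined, and that have only vertices already joined between them, are
joined by a cup. -/
def cupsAfter {N : ℕ} (a : Fin N → Label) : ℕ → Finset (Fin N × Fin N)
  | 0 => ∅
  | t + 1 => cupsAfter a t ∪ Finset.univ.filter fun p : Fin N × Fin N =>
      p.1 < p.2 ∧ a p.1 = Label.down ∧ a p.2 = Label.up ∧
        IsFree (cupsAfter a t) p.1 ∧ IsFree (cupsAfter a t) p.2 ∧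
        ∀ s, p.1 < s → s < p.2 → ¬ IsFree (cupsAfter a t) s

/-- The cups of the cup diagram of `a` (equivalently the caps of its cap diagram), each given by
its left and its right vertex.  A round that is not the last adds a cup, so the process has stopped
after `N` rounds.  The vertices that are free at the end carry the rays. -/
def cups {N : ℕ} (a : Fin N → Label) : Finset (Fin N × Fin N) :=
  cupsAfter a N

/-- `Oriented u a`: the diagram obtained by gluing the cup diagram of `u` under the weight `a` is
oriented.  Equivalently, the cap diagram of `u` glued on top of `a` is oriented. -/
def Oriented {N : ℕ} (u a : Fin N → Label) : Prop :=
  (∀ p ∈ cups u, a p.1 ≠ a p.2) ∧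
    ∀ i j, i < j → IsFree (cups u) i → IsFree (cups u) j →
      ¬ (a i = Label.down ∧ a j = Label.up)

instance {N : ℕ} (u a : Fin N → Label) : Decidable (Oriented u a) :=
  inferInstanceAs (Decidable (_ ∧ _))

/-- The number of clockwise oriented cups (equivalently, caps), that is those labelled `∧ ∨` from
left to right. -/
def clockwiseCount {N : ℕ} (u a : Fin N → Label) : ℕ :=
  ((cups u).filter fun p => a p.1 = Label.up).card

/-- The arc diagrams: the cup diagram of `bot` glued under the weight `wt`, and the cap diagram of
`top` glued on top of it, such that both halves are oriented. -/
@[ext]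
structure ArcDiagram (m n : ℕ) where
  bot : Weight m n
  wt : Weight m n
  top : Weight m n
  oriented_bot : Oriented bot.1 wt.1
  oriented_top : Oriented top.1 wt.1

/-- The degree of an arc diagram. -/
def ArcDiagram.degree {m n : ℕ} (d : ArcDiagram m n) : ℕ :=
  clockwiseCount d.bot.1 d.wt.1 + clockwiseCount d.top.1 d.wt.1

/-! ### Stacked diagrams and surgery -/

/-- A diagram that arises when one arc diagram is placed under another one and some of the
surgeries have been done.  It has a lower and an upper weight line with `N` vertices each; the
vertex `i` of the lower line is `(0, i)` and that of the upper line is `(1, i)`.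
* `lower` are the cups below the lower weight line.
* `upper` are the caps above the upper weight line.
* `middle` are the pairs of arcs in the middle section on which no surgery has been done: `(i, j)`
  stands for a cap on the vertices `(0, i)`, `(0, j)` and its mirror image, a cup on the vertices
  `(1, i)`, `(1, j)`.
At all the other positions `i` the middle section has a vertical segment from `(0, i)` to `(1, i)`
(two rays glued together, or the result of a surgery).  The vertices that are on no arc of `lower`
carry a ray to the bottom, those that are on no arc of `upper` carry a ray to the top. -/
structure StackedDiagram (N : ℕ) where
  lower : Finset (Fin N × Fin N)
  middle : Finset (Fin N × Fin N)
  upper : Finset (Fin N × Fin N)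

namespace StackedDiagram

variable {N : ℕ}

/-- There is a cup or a cap with left vertex `u` and right vertex `v`. -/
def IsArc (D : StackedDiagram N) (u v : Fin 2 × Fin N) : Prop :=
  (u.1 = 0 ∧ v.1 = 0 ∧ (u.2, v.2) ∈ D.lower) ∨ (u.1 = 1 ∧ v.1 = 1 ∧ (u.2, v.2) ∈ D.upper) ∨
    (u.1 = v.1 ∧ (u.2, v.2) ∈ D.middle)

/-- There is a vertical segment in the middle section from `u` up to `v`. -/
def IsSegment (D : StackedDiagram N) (u v : Fin 2 × Fin N) : Prop :=
  u.1 = 0 ∧ v.1 = 1 ∧ u.2 = v.2 ∧ IsFree D.middle u.2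

/-- Two vertices are adjacent if they are joined by an arc or by a vertical segment. -/
def graph (D : StackedDiagram N) : SimpleGraph (Fin 2 × Fin N) :=
  SimpleGraph.fromRel fun u v => D.IsArc u v ∨ D.IsSegment u v

/-- The vertices `u` and `v` are on the same circle or strand. -/
def SameComponent (D : StackedDiagram N) (u v : Fin 2 × Fin N) : Prop :=
  D.graph.Reachable u v

/-- The vertex `v` carries a ray to the bottom of the diagram. -/
def IsBottomRay (D : StackedDiagram N) (v : Fin 2 × Fin N) : Prop :=
  v.1 = 0 ∧ IsFree D.lower v.2

/-- The vertex `v` carries a ray to the top of the diagram. -/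
def IsTopRay (D : StackedDiagram N) (v : Fin 2 × Fin N) : Prop :=
  v.1 = 1 ∧ IsFree D.upper v.2

/-- A labelling of the vertices is an orientation of the diagram if the ends of each cup and cap
have different labels and the ends of each vertical segment have the same label. -/
def IsOrientation (D : StackedDiagram N) (o : Fin 2 × Fin N → Label) : Prop :=
  (∀ u v, D.IsArc u v → o u ≠ o v) ∧ ∀ u v, D.IsSegment u v → o u = o v

/-- The component of `v` is a strand (and not a circle): it has an end. -/
def IsStrand (D : StackedDiagram N) (v : Fin 2 × Fin N) : Prop :=
  ∃ w, D.SameComponent v w ∧ (D.IsBottomRay w ∨ D.IsTopRay w)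

/-- The component of `v` is a propagating strand: it goes from the bottom to the top. -/
def IsPropagating (D : StackedDiagram N) (v : Fin 2 × Fin N) : Prop :=
  (∃ w, D.SameComponent v w ∧ D.IsBottomRay w) ∧ ∃ w, D.SameComponent v w ∧ D.IsTopRay w

/-- A vertex of the component of `v` that is as far to the left as possible has label `l`. -/
def LeftmostLabel (D : StackedDiagram N) (o : Fin 2 × Fin N → Label) (v : Fin 2 × Fin N)
    (l : Label) : Prop :=
  ∃ w, D.SameComponent v w ∧ (∀ w', D.SameComponent v w' → w.2 ≤ w'.2) ∧ o w = l

/-- The component of `v` is a strand whose rays are all labelled `l`. -/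
def StrandLabel (D : StackedDiagram N) (o : Fin 2 × Fin N → Label) (v : Fin 2 × Fin N)
    (l : Label) : Prop :=
  D.IsStrand v ∧ ∀ w, D.SameComponent v w → (D.IsBottomRay w ∨ D.IsTopRay w) → o w = l

end StackedDiagram

/-- The kinds of oriented components: `one` is an anti-clockwise circle, `x` is a clockwise circle
and `y` is an oriented strand. -/
inductive Kind
  | one
  | x
  | y
  deriving DecidableEq

/-- The component of `v` in the diagram `D` with orientation `o` is of the given kind.  An oriented
circle is anti-clockwise if it runs downwards at its leftmost vertex, and clockwise if it runs
upwards there. -/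
def StackedDiagram.HasKind {N : ℕ} (D : StackedDiagram N) (o : Fin 2 × Fin N → Label)
    (v : Fin 2 × Fin N) : Kind → Prop
  | Kind.one => ¬ D.IsStrand v ∧ D.LeftmostLabel o v Label.down
  | Kind.x => ¬ D.IsStrand v ∧ D.LeftmostLabel o v Label.up
  | Kind.y => D.IsStrand v

/-- `Splits s t t'` : the term `t ⊗ t'` occurs in the splitting rules
`1 ↦ 1 ⊗ x + x ⊗ 1`, `x ↦ x ⊗ x`, `y ↦ x ⊗ y` for `s`. -/
inductive Splits : Kind → Kind → Kind → Prop
  | one_left : Splits Kind.one Kind.one Kind.x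
  | one_right : Splits Kind.one Kind.x Kind.one
  | x : Splits Kind.x Kind.x Kind.x
  | y_left : Splits Kind.y Kind.x Kind.y
  | y_right : Splits Kind.y Kind.y Kind.x

/-- `Merges s s' t` : the merging rules give `s ⊗ s' ↦ t`, where `1 ⊗ 1 ↦ 1`, `1 ⊗ x ↦ x`,
`x ⊗ 1 ↦ x`, `1 ⊗ y ↦ y`, `y ⊗ 1 ↦ y`, and `x ⊗ x`, `x ⊗ y`, `y ⊗ x` go to zero. -/
inductive Merges : Kind → Kind → Kind → Prop
  | one_one : Merges Kind.one Kind.one Kind.one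
  | one_x : Merges Kind.one Kind.x Kind.x
  | x_one : Merges Kind.x Kind.one Kind.x
  | one_y : Merges Kind.one Kind.y Kind.y
  | y_one : Merges Kind.y Kind.one Kind.y

namespace StackedDiagram

variable {N : ℕ}

/-- The diagram after the surgery on the pair `p = (i, j)` of the middle section: the cap and the
cup are replaced by two vertical segments, at `i` and at `j`. -/
def cut (D : StackedDiagram N) (p : Fin N × Fin N) : StackedDiagram N :=
  { D with middle := D.middle.erase p }

/-- The rules for re-orientation: the orientation `o'` of `D.cut p` is one of the terms in the
result of the surgery on the pair `p` in the diagram `D` with orientation `o`.  The components that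
are not involved keep their orientation, and so do the ends of all strands.  If the cap and the cup
of `p` are on one component, it is split into two, and a splitting rule applies.  If they are on
two components, of which at least one is a circle, these are merged and a merging rule
applies.  If they are on two strands, these are reconnected to two strands; the orientation at the
ends stays as it is if both strands are propagating, one is `∧`-oriented and the other is
`∨`-oriented, and otherwise the result is zero. -/
def Surgery (D : StackedDiagram N) (p : Fin N × Fin N) (o o' : Fin 2 × Fin N → Label) : Prop :=
  (D.cut p).IsOrientation o' ∧
  (∀ v, ¬ D.SameComponent (0, p.1) v → ¬ D.SameComponent (1, p.1) v → o' v = o v) ∧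
  (∀ v, D.IsBottomRay v ∨ D.IsTopRay v → o' v = o v) ∧
  ((D.SameComponent (0, p.1) (1, p.1) ∧
      ∃ s t t', Splits s t t' ∧ D.HasKind o (0, p.1) s ∧
        (D.cut p).HasKind o' (0, p.1) t ∧ (D.cut p).HasKind o' (0, p.2) t') ∨
    (¬ D.SameComponent (0, p.1) (1, p.1) ∧
      ∃ s s' t, Merges s s' t ∧ D.HasKind o (0, p.1) s ∧ D.HasKind o (1, p.1) s' ∧
        (D.cut p).HasKind o' (0, p.1) t) ∨
    (¬ D.SameComponent (0, p.1) (1, p.1) ∧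
      D.IsPropagating (0, p.1) ∧ D.IsPropagating (1, p.1) ∧
      ∃ l l', l ≠ l' ∧ D.StrandLabel o (0, p.1) l ∧ D.StrandLabel o (1, p.1) l'))

open Classical in
/-- The coefficient of the orientation `o'` in the result of doing the surgeries on the pairs in
the given list, one after the other, starting with the orientation `o` of `D`. -/
noncomputable def surgeryCoeff :
    List (Fin N × Fin N) → StackedDiagram N → (o o' : Fin 2 × Fin N → Label) → ℕ
  | [], _, o, o' => if o = o' then 1 else 0
  | p :: ps, D, o, o' => ∑ o₁ : Fin 2 × Fin N → Label,
      if D.Surgery p o o₁ then surgeryCoeff ps (D.cut p) o₁ o' else 0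

end StackedDiagram

/-- The arcs of the cup diagram of `a`, listed by their left vertices from left to right.  Each arc
comes after all the arcs that enclose it, so the surgeries can be done in this order: in the middle
section of a stacked diagram, the cap and the cup of the next pair face each other. -/
def cupList {N : ℕ} (a : Fin N → Label) : List (Fin N × Fin N) :=
  (List.finRange N ×ˢ List.finRange N).filter fun p => p ∈ cups a

/-! ### The algebra -/

/-- The extended Khovanov arc algebra `𝒦_{m,n}` over `R`: the free `R`-module on the arc diagrams,
with the multiplication given by surgery. -/
def KhovanovArcAlgebra (R : Type*) [CommRing R] (m n : ℕ) : Type _ := ArcDiagram m n →₀ R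

namespace KhovanovArcAlgebra

variable (R : Type*) [CommRing R] {m n : ℕ}

noncomputable instance : AddCommGroup (KhovanovArcAlgebra R m n) :=
  inferInstanceAs (AddCommGroup (ArcDiagram m n →₀ R))

noncomputable instance : Module R (KhovanovArcAlgebra R m n) :=
  inferInstanceAs (Module R (ArcDiagram m n →₀ R))

/-- The basis vector given by an arc diagram. -/
noncomputable def ofDiagram (d : ArcDiagram m n) : KhovanovArcAlgebra R m n :=
  (Finsupp.single d 1 : ArcDiagram m n →₀ R)

/-- The product of two arc diagrams: zero unless the cap diagram of `d` mirrors the cup diagram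
of `d'`; in this case place `d` under `d'`, do the surgery on all the pairs of arcs in the
middle section, and then identify the two weight lines. -/
noncomputable def diagramMul (d d' : ArcDiagram m n) : KhovanovArcAlgebra R m n :=
  if d.top = d'.bot then
    ∑ a : Weight m n,
      if h : Oriented d.bot.1 a.1 ∧ Oriented d'.top.1 a.1 then
        ((StackedDiagram.surgeryCoeff (cupList d.top.1)
            { lower := cups d.bot.1, middle := cups d.top.1, upper := cups d'.top.1 }
            (fun v => if v.1 = 0 then d.wt.1 v.2 else d'.wt.1 v.2)
            (fun v => a.1 v.2) : ℕ) : R) •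
          ofDiagram R { bot := d.bot, wt := a, top := d'.top,
                        oriented_bot := h.1, oriented_top := h.2 }
      else 0
  else 0

/-- The bilinear extension of the product of arc diagrams. -/
noncomputable def mulHom :
    KhovanovArcAlgebra R m n →ₗ[R] KhovanovArcAlgebra R m n →ₗ[R] KhovanovArcAlgebra R m n :=
  Finsupp.linearCombination R fun d : ArcDiagram m n =>
    (Finsupp.linearCombination R fun d' : ArcDiagram m n => diagramMul R d d' :
      (ArcDiagram m n →₀ R) →ₗ[R] KhovanovArcAlgebra R m n)

noncomputable instance : NonUnitalNonAssocRing (KhovanovArcAlgebra R m n) :=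
  { (inferInstance : AddCommGroup (KhovanovArcAlgebra R m n)) with
    mul := fun f g => mulHom R f g
    left_distrib := fun f g h => map_add (mulHom R f) g h
    right_distrib := fun f g h => LinearMap.congr_fun (map_add (mulHom R) f g) h
    zero_mul := fun f => LinearMap.congr_fun (map_zero (mulHom R)) f
    mul_zero := fun f => map_zero (mulHom R f) }

instance : IsScalarTower R (KhovanovArcAlgebra R m n) (KhovanovArcAlgebra R m n) :=
  ⟨fun r f g => LinearMap.congr_fun (map_smul (mulHom R) r f) g⟩

instance : SMulCommClass R (KhovanovArcAlgebra R m n) (KhovanovArcAlgebra R m n) :=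
  ⟨fun r f g => (map_smul (mulHom R f) r g).symm⟩

theorem ofDiagram_mul_ofDiagram (d d' : ArcDiagram m n) :
    ofDiagram R d * ofDiagram R d' = diagramMul R d d' := by
  have h₁ : mulHom R (ofDiagram R d) =
      (Finsupp.linearCombination R fun d' : ArcDiagram m n => diagramMul R d d') :=
    (Finsupp.linearCombination_single R 1 d).trans (one_smul R _)
  have h₂ : mulHom R (ofDiagram R d) (ofDiagram R d') = diagramMul R d d' := by
    rw [h₁]
    exact (Finsupp.linearCombination_single R 1 d').trans (one_smul R _)
  exact h₂

/-- The homogeneous component of degree `e`: the span of the arc diagrams of degree `e`. -/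
noncomputable def gradedPiece (m n : ℕ) (e : ℕ) : Submodule R (KhovanovArcAlgebra R m n) :=
  Submodule.span R {f | ∃ d : ArcDiagram m n, d.degree = e ∧ f = ofDiagram R d}

end KhovanovArcAlgebra

end ArcAlgebra

/-! Dilation inserts two neighbouring vertices labelled `∨ ∧`. Cup diagrams are determined by being
nested and maximal, so a dilated cup diagram is the old one with one extra small cup on the new
vertices (`Insertion.Extends.cups_eq`). The weight labels this cup anti-clockwise, so orientability
and degree do not change.

When two dilated arc diagrams are stacked, the new vertices form one small circle on each weight
line, disjoint from everything else. A surgery on an old pair neither sees nor changes these circles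
(`surgery_arc`, `exists_eq_extendOrientation_of_surgery_arc`). The surgery on the new pair merges
them by `1 ⊗ 1 ↦ 1` and has exactly one outcome, which again labels the new vertices `∨ ∧`
(`surgery_newArc`). Hence, wherever the new pair stands in the order of surgeries, the coefficient
of a dilated weight is the old coefficient (`surgeryCoeff_insert`), and every other weight has
coefficient zero (`surgeryCoeff_insert_eq_zero`). The structure constants therefore agree, and the
linear extension is multiplicative. It is injective because dilation is injective on the basis.

One point needs counting. The surgery on the new pair has its expected outcome only if the labelling
at that stage is an orientation. Later stages are oriented by the definition of `Surgery`; for the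
initial stack, the two weights must agree at the glued rays. They do, because the rays of an
oriented diagram read `∧ … ∧ ∨ … ∨` and the number of `∧` among them is fixed
(`Oriented.eq_of_isFree`). -/

namespace ArcAlgebra

/-! ### A characterisation of cup diagrams -/

/-- A set of pairwise disjoint, properly nested arcs joining labels `∨ ∧`, such that all the
vertices under an arc are joined to each other. -/
structure IsPartialCupDiagram {N : ℕ} (a : Fin N → Label) (C : Finset (Fin N × Fin N)) : Prop where
  lt : ∀ p ∈ C, p.1 < p.2
  down : ∀ p ∈ C, a p.1 = Label.down
  up : ∀ p ∈ C, a p.2 = Label.up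
  eq_of_left : ∀ p ∈ C, ∀ q ∈ C, p.1 = q.1 → p = q
  eq_of_right : ∀ p ∈ C, ∀ q ∈ C, p.2 = q.2 → p = q
  nested : ∀ p ∈ C, ∀ s, p.1 < s → s < p.2 → ∃ q ∈ C, p.1 < q.1 ∧ q.2 < p.2 ∧ (q.1 = s ∨ q.2 = s)

/-- A partial cup diagram to which no further cup can be added. -/
structure IsCupDiagram {N : ℕ} (a : Fin N → Label) (C : Finset (Fin N × Fin N)) : Prop extends
    IsPartialCupDiagram a C where
  maximal : ∀ i j, i < j → a i = Label.down → a j = Label.up → IsFree C i → IsFree C j →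
    ∃ s, i < s ∧ s < j ∧ IsFree C s

theorem not_isFree_iff {N : ℕ} {C : Finset (Fin N × Fin N)} {i : Fin N} :
    ¬ IsFree C i ↔ ∃ p ∈ C, p.1 = i ∨ p.2 = i := by
  simp only [IsFree, not_forall, exists_prop, not_and_or, not_not]

theorem IsPartialCupDiagram.not_isFree_of_between {N : ℕ} {a : Fin N → Label}
    {C : Finset (Fin N × Fin N)} (h : IsPartialCupDiagram a C) {p : Fin N × Fin N} (hp : p ∈ C)
    {s : Fin N} (h₁ : p.1 < s) (h₂ : s < p.2) : ¬ IsFree C s := by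
  obtain ⟨q, hq, -, -, hs⟩ := h.nested p hp s h₁ h₂
  exact not_isFree_iff.2 ⟨q, hq, hs⟩

/-- Strong induction on the length of the arc: the arcs of `C` under `p` are shorter, hence belong
to `C'` and use up all vertices under `p`. In `C'` neither end of `p` can then be joined to a vertex
under `p`, and nesting and maximality of `C'` leave only `p` itself. -/
theorem IsCupDiagram.mem_of_mem {N : ℕ} {a : Fin N → Label} {C C' : Finset (Fin N × Fin N)}
    (h : IsCupDiagram a C) (h' : IsCupDiagram a C') :
    ∀ d : ℕ, ∀ p ∈ C, (p.2 : ℕ) - p.1 = d → p ∈ C' := by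
  intro d
  induction d using Nat.strong_induction_on with
  | _ d ih =>
    rintro ⟨i, j⟩ hp hd
    have hij : i < j := h.lt _ hp
    have inner : ∀ s, i < s → s < j → ∃ q ∈ C', i < q.1 ∧ q.2 < j ∧ (q.1 = s ∨ q.2 = s) := by
      intro s h₁ h₂
      obtain ⟨q, hq, hq₁, hq₂, hs⟩ := h.nested _ hp s h₁ h₂
      have := h.lt _ hq
      simp only at hd hq₁ hq₂
      exact ⟨q, ih _ (by omega) q hq rfl, hq₁, hq₂, hs⟩
    have hi := h.down _ hp
    have hj := h.up _ hp
    simp only at hi hj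
    have no_left : ∀ q ∈ C', q.2 = j → ¬ i < q.1 := by
      intro q hq hqj hlt
      obtain ⟨r, hr, -, hr₂, hs⟩ := inner q.1 hlt (hqj ▸ h'.lt q hq)
      rcases hs with hs | hs
      · have := h'.eq_of_left r hr q hq hs
        subst this
        exact absurd hqj hr₂.ne
      · have h₁ := h'.up r hr
        rw [hs, h'.down q hq] at h₁
        cases h₁
    have no_right : ∀ q ∈ C', q.1 = i → ¬ q.2 < j := by
      intro q hq hqi hlt
      obtain ⟨r, hr, hr₁, -, hs⟩ := inner q.2 (hqi ▸ h'.lt q hq) hlt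
      rcases hs with hs | hs
      · have h₁ := h'.up q hq
        rw [← hs, h'.down r hr] at h₁
        cases h₁
      · have := h'.eq_of_right r hr q hq hs
        subst this
        exact absurd hqi hr₁.ne'
    by_cases fi : IsFree C' i
    · by_cases fj : IsFree C' j
      · obtain ⟨s, h₁, h₂, hs⟩ := h'.maximal i j hij hi hj fi fj
        obtain ⟨q, hq, -, -, hqs⟩ := inner s h₁ h₂
        exact absurd hs (not_isFree_iff.2 ⟨q, hq, hqs⟩)
      · obtain ⟨q, hq, hqj⟩ := not_isFree_iff.1 fj
        rcases hqj with hqj | hqj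
        · have h₁ := h'.down q hq
          rw [hqj, hj] at h₁
          cases h₁
        · rcases lt_trichotomy q.1 i with hlt | heq | hgt
          · exact absurd fi (h'.not_isFree_of_between hq hlt (hqj ▸ hij))
          · exact absurd heq (fi q hq).1
          · exact absurd hgt (no_left q hq hqj)
    · obtain ⟨q, hq, hqi⟩ := not_isFree_iff.1 fi
      rcases hqi with hqi | hqi
      · rcases lt_trichotomy q.2 j with hlt | heq | hgt
        · exact absurd hlt (no_right q hq hqi)
        · rw [← hqi, ← heq]
          exact hq
        -- An arc of `C'` from `i` reaching beyond `j` encloses `j`, so nesting would join `j` to a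
        -- vertex between `i` and `j`.
        · obtain ⟨r, hr, hr₁, -, hrj⟩ := h'.nested q hq j (hqi ▸ hij) hgt
          rcases hrj with hrj | hrj
          · have h₁ := h'.down r hr
            rw [hrj, hj] at h₁
            cases h₁
          · exact absurd (hqi ▸ hr₁) (no_left r hr hrj)
      · have h₁ := h'.up q hq
        rw [hqi, hi] at h₁
        cases h₁

/-- Uniqueness allows cup diagrams on strips of different sizes to be compared without matching the
rounds of the two recursions. -/
theorem IsCupDiagram.unique {N : ℕ} {a : Fin N → Label} {C C' : Finset (Fin N × Fin N)}
    (h : IsCupDiagram a C) (h' : IsCupDiagram a C') : C = C' :=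
  Finset.ext fun p => ⟨fun hp => h.mem_of_mem h' _ p hp rfl, fun hp => h'.mem_of_mem h _ p hp rfl⟩

theorem isPartialCupDiagram_cupsAfter {N : ℕ} (a : Fin N → Label) (t : ℕ) :
    IsPartialCupDiagram a (cupsAfter a t) := by
  induction t with
  | zero => constructor <;> simp [cupsAfter]
  | succ t ih =>
    have key : ∀ p, p ∈ cupsAfter a (t + 1) ↔ p ∈ cupsAfter a t ∨
        (p.1 < p.2 ∧ a p.1 = Label.down ∧ a p.2 = Label.up ∧
        IsFree (cupsAfter a t) p.1 ∧ IsFree (cupsAfter a t) p.2 ∧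
        ∀ s, p.1 < s → s < p.2 → ¬ IsFree (cupsAfter a t) s) := by
      intro p
      simp [cupsAfter]
    constructor
    · intro p hp
      rcases (key p).1 hp with hp | hp
      exacts [ih.lt p hp, hp.1]
    · intro p hp
      rcases (key p).1 hp with hp | hp
      exacts [ih.down p hp, hp.2.1]
    · intro p hp
      rcases (key p).1 hp with hp | hp
      exacts [ih.up p hp, hp.2.2.1]
    · intro p hp q hq hpq
      rcases (key p).1 hp with hp | hp <;> rcases (key q).1 hq with hq | hq
      · exact ih.eq_of_left p hp q hq hpq
      · exact absurd hpq (hq.2.2.2.1 p hp).1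
      · exact absurd hpq.symm (hp.2.2.2.1 q hq).1
      · rcases lt_trichotomy p.2 q.2 with h | h | h
        · exact absurd hp.2.2.2.2.1 (hq.2.2.2.2.2 p.2 (hpq ▸ hp.1) h)
        · exact Prod.ext hpq h
        · exact absurd hq.2.2.2.2.1 (hp.2.2.2.2.2 q.2 (hpq ▸ hq.1) h)
    · intro p hp q hq hpq
      rcases (key p).1 hp with hp | hp <;> rcases (key q).1 hq with hq | hq
      · exact ih.eq_of_right p hp q hq hpq
      · exact absurd hpq (hq.2.2.2.2.1 p hp).2
      · exact absurd hpq.symm (hp.2.2.2.2.1 q hq).2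
      · rcases lt_trichotomy p.1 q.1 with h | h | h
        · exact absurd hq.2.2.2.1 (hp.2.2.2.2.2 q.1 h (hpq ▸ hq.1))
        · exact Prod.ext h hpq
        · exact absurd hp.2.2.2.1 (hq.2.2.2.2.2 p.1 h (hpq ▸ hp.1))
    · intro p hp s h₁ h₂
      rcases (key p).1 hp with hp | hp
      · obtain ⟨q, hq, hs⟩ := ih.nested p hp s h₁ h₂
        exact ⟨q, (key q).2 (Or.inl hq), hs⟩
      · obtain ⟨-, -, -, f₁, f₂, hs⟩ := hp
        obtain ⟨q, hq, hqs⟩ := not_isFree_iff.1 (hs s h₁ h₂)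
        have hlt := ih.lt q hq
        -- The ends of the new cup were free before this round, so an older arc `q` through a vertex
        -- under the cup cannot enclose either end; hence `q` lies entirely under it.
        have n₁ : ¬ (q.1 < p.1 ∧ p.1 < q.2) := fun h => ih.not_isFree_of_between hq h.1 h.2 f₁
        have n₂ : ¬ (q.1 < p.2 ∧ p.2 < q.2) := fun h => ih.not_isFree_of_between hq h.1 h.2 f₂
        have := f₁ q hq
        have := f₂ q hq
        exact ⟨q, (key q).2 (Or.inl hq), by omega, by omega, hqs⟩

theorem IsPartialCupDiagram.card_le {N : ℕ} {a : Fin N → Label} {C : Finset (Fin N × Fin N)}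
    (h : IsPartialCupDiagram a C) : C.card ≤ N := by
  have := Finset.card_le_card_of_injOn Prod.fst (fun p _ => Finset.mem_univ p.1)
    (fun p hp q hq hpq => h.eq_of_left p hp q hq hpq)
  simpa using this

/-- A round that changes something adds at least one arc, and a round that changes nothing is
followed by another such round. -/
theorem le_card_cupsAfter_or_stable {N : ℕ} (a : Fin N → Label) (t : ℕ) :
    t ≤ (cupsAfter a t).card ∨ cupsAfter a (t + 1) = cupsAfter a t := by
  induction t with
  | zero => exact Or.inl (Nat.zero_le _)
  | succ t ih =>
    by_cases hst : cupsAfter a (t + 1) = cupsAfter a t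
    · right
      change cupsAfter a (t + 1) ∪ _ = _
      rw [hst]
      exact hst
    · left
      have hss : cupsAfter a t ⊂ cupsAfter a (t + 1) :=
        (Finset.subset_union_left).ssubset_of_ne (Ne.symm hst)
      have := Finset.card_lt_card hss
      rcases ih with ih | ih
      · omega
      · exact absurd ih hst

/-- If round `N + 1` still added an arc, there would be at least `N + 1` arcs, but distinct arcs
have distinct left ends among `N` vertices. -/
theorem cupsAfter_succ_eq {N : ℕ} (a : Fin N → Label) : cupsAfter a (N + 1) = cupsAfter a N := by
  by_contra hst
  have h₁ := (le_card_cupsAfter_or_stable a N).resolve_right hst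
  have hss : cupsAfter a N ⊂ cupsAfter a (N + 1) :=
    (Finset.subset_union_left).ssubset_of_ne (Ne.symm hst)
  have h₂ := Finset.card_lt_card hss
  have h₃ := (isPartialCupDiagram_cupsAfter a (N + 1)).card_le
  omega

theorem isCupDiagram_cups {N : ℕ} (a : Fin N → Label) : IsCupDiagram a (cups a) where
  toIsPartialCupDiagram := isPartialCupDiagram_cupsAfter a N
  maximal := by
    intro i j hij hi hj fi fj
    by_contra hno
    push Not at hno
    have hmem : (i, j) ∈ cupsAfter a (N + 1) := by
      change _ ∈ cupsAfter a N ∪ _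
      refine Finset.mem_union_right _ (Finset.mem_filter.2 ⟨Finset.mem_univ _, ?_⟩)
      exact ⟨hij, hi, hj, fi, fj, hno⟩
    rw [cupsAfter_succ_eq] at hmem
    exact (fi _ hmem).1 rfl

/-! ### Insertion of two adjacent vertices -/

/-- An increasing map that misses exactly two vertices, which are neighbours. -/
structure Insertion (N M : ℕ) where
  emb : Fin N → Fin M
  left : Fin M
  right : Fin M
  strictMono : StrictMono emb
  right_eq : (right : ℕ) = left + 1
  emb_ne_left : ∀ i, emb i ≠ left
  emb_ne_right : ∀ i, emb i ≠ right
  cover : ∀ j, j = left ∨ j = right ∨ ∃ i, emb i = j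

namespace Insertion

variable {N M : ℕ} (E : Insertion N M)

theorem left_lt_right : E.left < E.right := by
  have := E.right_eq
  omega

theorem left_ne_right : E.left ≠ E.right := E.left_lt_right.ne

/-- The image of an arc. -/
def arc (p : Fin N × Fin N) : Fin M × Fin M := (E.emb p.1, E.emb p.2)

/-- The arc joining the two new vertices. -/
def newArc : Fin M × Fin M := (E.left, E.right)

theorem arc_injective : Function.Injective E.arc := by
  rintro ⟨i, j⟩ ⟨i', j'⟩ h
  simp only [arc, Prod.mk.injEq] at h
  rw [E.strictMono.injective h.1, E.strictMono.injective h.2]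

theorem arc_ne_newArc (p : Fin N × Fin N) : E.arc p ≠ E.newArc := fun h =>
  E.emb_ne_left p.1 (congrArg Prod.fst h)

/-- The images of the given arcs together with some further arcs. -/
def arcs (S : Finset (Fin M × Fin M)) (C : Finset (Fin N × Fin N)) : Finset (Fin M × Fin M) :=
  S ∪ C.image E.arc

theorem mem_arcs {S : Finset (Fin M × Fin M)} {C : Finset (Fin N × Fin N)} {p : Fin M × Fin M} :
    p ∈ E.arcs S C ↔ p ∈ S ∨ ∃ q ∈ C, E.arc q = p := by
  simp [arcs]

/-- The hypothesis `S ⊆ {E.newArc}` covers both states of the middle section: the new arc is present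
before its surgery and absent afterwards. -/
theorem isFree_arcs {S : Finset (Fin M × Fin M)} (hS : S ⊆ {E.newArc})
    {C : Finset (Fin N × Fin N)} {i : Fin N} : IsFree (E.arcs S C) (E.emb i) ↔ IsFree C i := by
  constructor
  · intro h p hp
    have := h (E.arc p) (E.mem_arcs.2 (Or.inr ⟨p, hp, rfl⟩))
    exact ⟨fun e => this.1 (congrArg E.emb e), fun e => this.2 (congrArg E.emb e)⟩
  · intro h p hp
    rcases E.mem_arcs.1 hp with hp | ⟨q, hq, rfl⟩
    · rw [Finset.mem_singleton.1 (hS hp)]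
      exact ⟨(E.emb_ne_left i).symm, (E.emb_ne_right i).symm⟩
    · exact ⟨fun e => (h q hq).1 (E.strictMono.injective e),
        fun e => (h q hq).2 (E.strictMono.injective e)⟩

theorem not_isFree_left (C : Finset (Fin N × Fin N)) : ¬ IsFree (E.arcs {E.newArc} C) E.left :=
  fun h => (h _ (E.mem_arcs.2 (Or.inl (Finset.mem_singleton_self _)))).1 rfl

theorem not_isFree_right (C : Finset (Fin N × Fin N)) : ¬ IsFree (E.arcs {E.newArc} C) E.right :=
  fun h => (h _ (E.mem_arcs.2 (Or.inl (Finset.mem_singleton_self _)))).2 rfl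

/-- The labelling `a'` arises from `a` by labelling the two new vertices by `∨ ∧`. -/
structure Extends (a : Fin N → Label) (a' : Fin M → Label) : Prop where
  emb : ∀ i, a' (E.emb i) = a i
  left : a' E.left = Label.down
  right : a' E.right = Label.up

variable {E}

/-- The new arc joins neighbours, so nothing lies under it. Since no old vertex lies between them,
an old arc encloses both new vertices or neither. Maximality is inherited because the new vertices
are not free. -/
theorem Extends.isCupDiagram {a : Fin N → Label} {a' : Fin M → Label} (h : E.Extends a a')
    {C : Finset (Fin N × Fin N)} (hC : IsCupDiagram a C) :
    IsCupDiagram a' (E.arcs {E.newArc} C) := by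
  have key : ∀ p, p ∈ E.arcs {E.newArc} C ↔ p = E.newArc ∨ ∃ q ∈ C, E.arc q = p := by
    intro p
    rw [E.mem_arcs, Finset.mem_singleton]
  constructor
  · constructor
    · intro p hp
      rcases (key p).1 hp with rfl | ⟨q, hq, rfl⟩
      exacts [E.left_lt_right, E.strictMono (hC.lt q hq)]
    · intro p hp
      rcases (key p).1 hp with rfl | ⟨q, hq, rfl⟩
      exacts [h.left, (h.emb _).trans (hC.down q hq)]
    · intro p hp
      rcases (key p).1 hp with rfl | ⟨q, hq, rfl⟩
      exacts [h.right, (h.emb _).trans (hC.up q hq)]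
    · intro p hp p' hp' e
      rcases (key p).1 hp with rfl | ⟨q, hq, rfl⟩ <;>
        rcases (key p').1 hp' with rfl | ⟨q', hq', rfl⟩
      · rfl
      · exact absurd e.symm (E.emb_ne_left _)
      · exact absurd e (E.emb_ne_left _)
      · exact congrArg E.arc (hC.eq_of_left q hq q' hq' (E.strictMono.injective e))
    · intro p hp p' hp' e
      rcases (key p).1 hp with rfl | ⟨q, hq, rfl⟩ <;>
        rcases (key p').1 hp' with rfl | ⟨q', hq', rfl⟩
      · rfl
      · exact absurd e.symm (E.emb_ne_right _)
      · exact absurd e (E.emb_ne_right _)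
      · exact congrArg E.arc (hC.eq_of_right q hq q' hq' (E.strictMono.injective e))
    · intro p hp s h₁ h₂
      have hlr := E.right_eq
      rcases (key p).1 hp with rfl | ⟨q, hq, rfl⟩
      · simp only [newArc] at h₁ h₂
        omega
      · have n₁ := E.emb_ne_left q.1
        have n₂ := E.emb_ne_left q.2
        have n₃ := E.emb_ne_right q.1
        have n₄ := E.emb_ne_right q.2
        simp only [arc] at h₁ h₂
        rcases E.cover s with hs | hs | ⟨i, rfl⟩
        · exact ⟨E.newArc, (key _).2 (Or.inl rfl), by simp only [arc, newArc]; omega,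
            by simp only [arc, newArc]; omega, Or.inl hs.symm⟩
        · exact ⟨E.newArc, (key _).2 (Or.inl rfl), by simp only [arc, newArc]; omega,
            by simp only [arc, newArc]; omega, Or.inr hs.symm⟩
        · obtain ⟨r, hr, hr₁, hr₂, hs⟩ := hC.nested q hq i (E.strictMono.lt_iff_lt.1 h₁)
            (E.strictMono.lt_iff_lt.1 h₂)
          exact ⟨E.arc r, (key _).2 (Or.inr ⟨r, hr, rfl⟩), E.strictMono hr₁, E.strictMono hr₂,
            hs.imp (congrArg E.emb) (congrArg E.emb)⟩
  · intro i j hij hi hj fi fj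
    rcases E.cover i with rfl | rfl | ⟨i, rfl⟩
    · exact absurd fi (E.not_isFree_left C)
    · exact absurd fi (E.not_isFree_right C)
    rcases E.cover j with rfl | rfl | ⟨j, rfl⟩
    · exact absurd fj (E.not_isFree_left C)
    · exact absurd fj (E.not_isFree_right C)
    rw [h.emb] at hi hj
    rw [E.isFree_arcs subset_rfl] at fi fj
    obtain ⟨s, h₁, h₂, hs⟩ := hC.maximal i j (E.strictMono.lt_iff_lt.1 hij) hi hj fi fj
    exact ⟨E.emb s, E.strictMono h₁, E.strictMono h₂, (E.isFree_arcs subset_rfl).2 hs⟩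

theorem Extends.cups_eq {a : Fin N → Label} {a' : Fin M → Label} (h : E.Extends a a') :
    cups a' = E.arcs {E.newArc} (cups a) :=
  (isCupDiagram_cups a').unique (h.isCupDiagram (isCupDiagram_cups a))

theorem Extends.oriented_iff {u a : Fin N → Label} {u' a' : Fin M → Label} (hu : E.Extends u u')
    (ha : E.Extends a a') : Oriented u' a' ↔ Oriented u a := by
  unfold Oriented
  rw [hu.cups_eq]
  constructor
  · rintro ⟨h₁, h₂⟩
    refine ⟨fun p hp => ?_, fun i j hij fi fj => ?_⟩
    · have := h₁ (E.arc p) (E.mem_arcs.2 (Or.inr ⟨p, hp, rfl⟩))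
      simpa only [arc, ha.emb] using this
    · have := h₂ _ _ (E.strictMono hij) ((E.isFree_arcs subset_rfl).2 fi)
        ((E.isFree_arcs subset_rfl).2 fj)
      simpa only [ha.emb] using this
  · rintro ⟨h₁, h₂⟩
    refine ⟨fun p hp => ?_, fun i j hij fi fj => ?_⟩
    · rcases E.mem_arcs.1 hp with hp | ⟨q, hq, rfl⟩
      -- The new cup is always labelled `∨ ∧`; it is therefore oriented and uses no ray.
      · rw [Finset.mem_singleton.1 hp]
        simp [newArc, ha.left, ha.right]
      · simpa only [arc, ha.emb] using h₁ q hq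
    · rcases E.cover i with rfl | rfl | ⟨i, rfl⟩
      · exact absurd fi (E.not_isFree_left _)
      · exact absurd fi (E.not_isFree_right _)
      rcases E.cover j with rfl | rfl | ⟨j, rfl⟩
      · exact absurd fj (E.not_isFree_left _)
      · exact absurd fj (E.not_isFree_right _)
      rw [ha.emb, ha.emb]
      exact h₂ i j (E.strictMono.lt_iff_lt.1 hij) ((E.isFree_arcs subset_rfl).1 fi)
        ((E.isFree_arcs subset_rfl).1 fj)

theorem Extends.clockwiseCount_eq {u a : Fin N → Label} {u' a' : Fin M → Label}
    (hu : E.Extends u u') (ha : E.Extends a a') : clockwiseCount u' a' = clockwiseCount u a := by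
  have key : (cups u').filter (fun p => a' p.1 = Label.up)
      = ((cups u).filter fun p => a p.1 = Label.up).image E.arc := by
    rw [hu.cups_eq]
    ext p
    simp only [Finset.mem_filter, E.mem_arcs, Finset.mem_singleton, Finset.mem_image]
    constructor
    · rintro ⟨rfl | ⟨q, hq, rfl⟩, h⟩
      · simp [newArc, ha.left] at h
      · exact ⟨q, ⟨hq, by simpa only [arc, ha.emb] using h⟩, rfl⟩
    · rintro ⟨q, ⟨hq, h⟩, rfl⟩
      exact ⟨Or.inr ⟨q, hq, rfl⟩, by simpa only [arc, ha.emb] using h⟩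
  rw [clockwiseCount, key, Finset.card_image_of_injective _ E.arc_injective, clockwiseCount]

end Insertion

/-! ### Stacked diagrams with an inserted small circle -/

namespace Insertion

variable {N M : ℕ} (E : Insertion N M)

/-- The stacked diagram obtained by inserting the two new vertices into both weight lines, joined
by a cup at the bottom and a cap at the top, and with the further arcs `S` in the middle. -/
def diagram (S : Finset (Fin M × Fin M)) (D : StackedDiagram N) : StackedDiagram M where
  lower := E.arcs {E.newArc} D.lower
  middle := E.arcs S D.middle
  upper := E.arcs {E.newArc} D.upper

/-- The map on the vertices of stacked diagrams. -/
def vert (v : Fin 2 × Fin N) : Fin 2 × Fin M := (v.1, E.emb v.2)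

theorem vert_injective : Function.Injective E.vert := by
  rintro ⟨s, i⟩ ⟨t, j⟩ h
  simp only [vert, Prod.mk.injEq] at h
  rw [h.1, E.strictMono.injective h.2]

theorem cover_vert (w : Fin 2 × Fin M) : w.2 = E.left ∨ w.2 = E.right ∨ ∃ v, E.vert v = w := by
  rcases E.cover w.2 with h | h | ⟨i, h⟩
  exacts [Or.inl h, Or.inr (Or.inl h), Or.inr (Or.inr ⟨(w.1, i), Prod.ext rfl h⟩)]

theorem arc_mem_arcs {S : Finset (Fin M × Fin M)} (hS : S ⊆ {E.newArc})
    {C : Finset (Fin N × Fin N)} {p : Fin N × Fin N} : E.arc p ∈ E.arcs S C ↔ p ∈ C := by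
  rw [E.mem_arcs]
  constructor
  · rintro (h | ⟨q, hq, h⟩)
    · exact absurd (Finset.mem_singleton.1 (hS h)) (E.arc_ne_newArc p)
    · rwa [← E.arc_injective h]
  · exact fun h => Or.inr ⟨p, h, rfl⟩

/-- The orientation of the larger diagram that labels the new vertices by `∨ ∧` on both lines. -/
noncomputable def extendOrientation (o : Fin 2 × Fin N → Label) : Fin 2 × Fin M → Label :=
  Function.extend E.vert o fun w => if w.2 = E.left then Label.down else Label.up

@[simp]
theorem extendOrientation_vert (o : Fin 2 × Fin N → Label) (v : Fin 2 × Fin N) :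
    E.extendOrientation o (E.vert v) = o v :=
  E.vert_injective.extend_apply _ _ _

theorem extendOrientation_left (o : Fin 2 × Fin N → Label) (w : Fin 2 × Fin M)
    (hw : w.2 = E.left) : E.extendOrientation o w = Label.down := by
  rw [extendOrientation, Function.extend_apply', if_pos hw]
  rintro ⟨v, rfl⟩
  exact E.emb_ne_left _ hw

theorem extendOrientation_right (o : Fin 2 × Fin N → Label) (w : Fin 2 × Fin M)
    (hw : w.2 = E.right) : E.extendOrientation o w = Label.up := by
  rw [extendOrientation, Function.extend_apply', if_neg]
  · rw [hw]
    exact E.left_ne_right.symm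
  · rintro ⟨v, rfl⟩
    exact E.emb_ne_right _ hw

theorem extendOrientation_injective : Function.Injective E.extendOrientation := by
  intro o o' h
  funext v
  rw [← E.extendOrientation_vert o v, h, E.extendOrientation_vert]

/-- This describes the range of `extendOrientation`: it contains every labelling that is `∨` at the
left and `∧` at the right new vertex of both lines. -/
theorem eq_extendOrientation {o' : Fin 2 × Fin M → Label}
    (hl : ∀ w, w.2 = E.left → o' w = Label.down) (hr : ∀ w, w.2 = E.right → o' w = Label.up) :
    o' = E.extendOrientation fun v => o' (E.vert v) := by
  funext w
  rcases E.cover_vert w with h | h | ⟨v, rfl⟩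
  · rw [hl w h, E.extendOrientation_left _ w h]
  · rw [hr w h, E.extendOrientation_right _ w h]
  · rw [E.extendOrientation_vert]

/-! ### Components, rays and surgeries away from the inserted vertices -/

section Transfer

variable {S : Finset (Fin M × Fin M)} (hS : S ⊆ {E.newArc}) (D : StackedDiagram N)
include hS

theorem isArc_vert {u v : Fin 2 × Fin N} :
    (E.diagram S D).IsArc (E.vert u) (E.vert v) ↔ D.IsArc u v := by
  have h₁ := E.arc_mem_arcs subset_rfl (C := D.lower) (p := (u.2, v.2))
  have h₂ := E.arc_mem_arcs subset_rfl (C := D.upper) (p := (u.2, v.2))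
  have h₃ := E.arc_mem_arcs hS (C := D.middle) (p := (u.2, v.2))
  simp only [arc] at h₁ h₂ h₃
  simp only [StackedDiagram.IsArc, diagram, vert, h₁, h₂, h₃]

theorem isArc_cases {u v : Fin 2 × Fin M} (h : (E.diagram S D).IsArc u v) :
    (u.1 = v.1 ∧ u.2 = E.left ∧ v.2 = E.right) ∨ ∃ u' v', E.vert u' = u ∧ E.vert v' = v := by
  have key : ∀ {S' : Finset (Fin M × Fin M)} {C : Finset (Fin N × Fin N)}, S' ⊆ {E.newArc} →
      u.1 = v.1 → (u.2, v.2) ∈ E.arcs S' C →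
      (u.1 = v.1 ∧ u.2 = E.left ∧ v.2 = E.right) ∨ ∃ u' v', E.vert u' = u ∧ E.vert v' = v := by
    intro S' C hS' huv hm
    rcases E.mem_arcs.1 hm with hm | ⟨q, -, hq⟩
    · have := Finset.mem_singleton.1 (hS' hm)
      exact Or.inl ⟨huv, congrArg Prod.fst this, congrArg Prod.snd this⟩
    · exact Or.inr ⟨(u.1, q.1), (v.1, q.2), Prod.ext rfl (congrArg Prod.fst hq),
        Prod.ext rfl ((congrArg Prod.snd hq :))⟩
  rcases h with ⟨h₁, h₂, h⟩ | ⟨h₁, h₂, h⟩ | ⟨h₁, h⟩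
  · exact key subset_rfl (h₁.trans h₂.symm) h
  · exact key subset_rfl (h₁.trans h₂.symm) h
  · exact key hS h₁ h

theorem isSegment_vert {u v : Fin 2 × Fin N} :
    (E.diagram S D).IsSegment (E.vert u) (E.vert v) ↔ D.IsSegment u v := by
  simp only [StackedDiagram.IsSegment, diagram, vert, E.isFree_arcs hS,
    E.strictMono.injective.eq_iff]

theorem graph_adj_vert {u v : Fin 2 × Fin N} :
    (E.diagram S D).graph.Adj (E.vert u) (E.vert v) ↔ D.graph.Adj u v := by
  simp only [StackedDiagram.graph, SimpleGraph.fromRel_adj, E.isArc_vert hS, E.isSegment_vert hS,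
    ne_eq, E.vert_injective.eq_iff]

omit hS in
theorem mem_range_vert_of_eq {w : Fin 2 × Fin M} {i : Fin N} (h : E.emb i = w.2) :
    ∃ v, E.vert v = w := ⟨(w.1, i), Prod.ext rfl h⟩

/-- No edge joins an old vertex to a new one: arcs are either new or images of old arcs, and
segments preserve the horizontal position. Components of old vertices are therefore images of old
components. -/
theorem mem_range_of_graph_adj {u : Fin 2 × Fin N} {w : Fin 2 × Fin M}
    (h : (E.diagram S D).graph.Adj (E.vert u) w) : ∃ v, E.vert v = w := by
  rw [StackedDiagram.graph, SimpleGraph.fromRel_adj] at h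
  rcases h.2 with (h | h) | (h | h)
  · rcases E.isArc_cases hS D h with ⟨-, h, -⟩ | ⟨-, v, -, hv⟩
    exacts [absurd h (E.emb_ne_left _), ⟨v, hv⟩]
  · exact E.mem_range_vert_of_eq h.2.2.1
  · rcases E.isArc_cases hS D h with ⟨-, -, h⟩ | ⟨v, -, hv, -⟩
    exacts [absurd h (E.emb_ne_right _), ⟨v, hv⟩]
  · exact E.mem_range_vert_of_eq h.2.2.1.symm

theorem sameComponent_vert_iff {u : Fin 2 × Fin N} {w : Fin 2 × Fin M} :
    (E.diagram S D).SameComponent (E.vert u) w ↔ ∃ v, D.SameComponent u v ∧ E.vert v = w := by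
  constructor
  · intro h
    rw [StackedDiagram.SameComponent, SimpleGraph.reachable_iff_reflTransGen] at h
    induction h with
    | refl => exact ⟨u, SimpleGraph.Reachable.refl u, rfl⟩
    | tail _ hadj ih =>
      obtain ⟨v, hv, rfl⟩ := ih
      obtain ⟨v', rfl⟩ := E.mem_range_of_graph_adj hS D hadj
      exact ⟨v', hv.trans ((E.graph_adj_vert hS D).1 hadj).reachable, rfl⟩
  · rintro ⟨v, hv, rfl⟩
    exact hv.map (⟨E.vert, (E.graph_adj_vert hS D).2⟩ : D.graph →g (E.diagram S D).graph)

theorem sameComponent_vert {u v : Fin 2 × Fin N} :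
    (E.diagram S D).SameComponent (E.vert u) (E.vert v) ↔ D.SameComponent u v := by
  rw [E.sameComponent_vert_iff hS]
  constructor
  · rintro ⟨v', h, e⟩
    rwa [← E.vert_injective e]
  · exact fun h => ⟨v, h, rfl⟩

theorem exists_sameComponent_vert {u : Fin 2 × Fin N} {P : Fin 2 × Fin M → Prop} :
    (∃ w, (E.diagram S D).SameComponent (E.vert u) w ∧ P w) ↔
      ∃ v, D.SameComponent u v ∧ P (E.vert v) := by
  constructor
  · rintro ⟨w, h, hP⟩
    obtain ⟨v, hv, rfl⟩ := (E.sameComponent_vert_iff hS D).1 h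
    exact ⟨v, hv, hP⟩
  · rintro ⟨v, hv, hP⟩
    exact ⟨_, (E.sameComponent_vert hS D).2 hv, hP⟩

theorem forall_sameComponent_vert {u : Fin 2 × Fin N} {P : Fin 2 × Fin M → Prop} :
    (∀ w, (E.diagram S D).SameComponent (E.vert u) w → P w) ↔
      ∀ v, D.SameComponent u v → P (E.vert v) := by
  constructor
  · exact fun h v hv => h _ ((E.sameComponent_vert hS D).2 hv)
  · intro h w hw
    obtain ⟨v, hv, rfl⟩ := (E.sameComponent_vert_iff hS D).1 hw
    exact h v hv

omit hS in
theorem isBottomRay_vert {v : Fin 2 × Fin N} :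
    (E.diagram S D).IsBottomRay (E.vert v) ↔ D.IsBottomRay v := by
  simp only [StackedDiagram.IsBottomRay, diagram, vert, E.isFree_arcs subset_rfl]

omit hS in
theorem isTopRay_vert {v : Fin 2 × Fin N} :
    (E.diagram S D).IsTopRay (E.vert v) ↔ D.IsTopRay v := by
  simp only [StackedDiagram.IsTopRay, diagram, vert, E.isFree_arcs subset_rfl]

omit hS in
theorem mem_range_of_isRay {w : Fin 2 × Fin M}
    (h : (E.diagram S D).IsBottomRay w ∨ (E.diagram S D).IsTopRay w) : ∃ v, E.vert v = w := by
  rcases E.cover_vert w with hw | hw | hw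
  · rcases h with ⟨-, h⟩ | ⟨-, h⟩ <;> rw [hw] at h <;> exact absurd h (E.not_isFree_left _)
  · rcases h with ⟨-, h⟩ | ⟨-, h⟩ <;> rw [hw] at h <;> exact absurd h (E.not_isFree_right _)
  · exact hw

theorem isStrand_vert {v : Fin 2 × Fin N} :
    (E.diagram S D).IsStrand (E.vert v) ↔ D.IsStrand v := by
  simp only [StackedDiagram.IsStrand, E.exists_sameComponent_vert hS, E.isBottomRay_vert,
    E.isTopRay_vert]

theorem isPropagating_vert {v : Fin 2 × Fin N} :
    (E.diagram S D).IsPropagating (E.vert v) ↔ D.IsPropagating v := by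
  simp only [StackedDiagram.IsPropagating, E.exists_sameComponent_vert hS, E.isBottomRay_vert,
    E.isTopRay_vert]

/-- The strict monotonicity of `E.emb` keeps leftmost vertices leftmost, so circles keep their sense
of rotation. -/
theorem leftmostLabel_vert {o : Fin 2 × Fin N → Label} {v : Fin 2 × Fin N} {l : Label} :
    (E.diagram S D).LeftmostLabel (E.extendOrientation o) (E.vert v) l ↔
      D.LeftmostLabel o v l := by
  simp only [StackedDiagram.LeftmostLabel, E.exists_sameComponent_vert hS,
    E.forall_sameComponent_vert hS, E.extendOrientation_vert]
  simp only [vert, E.strictMono.le_iff_le]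

theorem strandLabel_vert {o : Fin 2 × Fin N → Label} {v : Fin 2 × Fin N} {l : Label} :
    (E.diagram S D).StrandLabel (E.extendOrientation o) (E.vert v) l ↔ D.StrandLabel o v l := by
  simp only [StackedDiagram.StrandLabel, E.forall_sameComponent_vert hS, E.isStrand_vert hS,
    E.extendOrientation_vert, E.isBottomRay_vert, E.isTopRay_vert]

theorem hasKind_vert {o : Fin 2 × Fin N → Label} {v : Fin 2 × Fin N} {s : Kind} :
    (E.diagram S D).HasKind (E.extendOrientation o) (E.vert v) s ↔ D.HasKind o v s := by
  cases s <;>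
    simp only [StackedDiagram.HasKind, E.isStrand_vert hS, E.leftmostLabel_vert hS]

theorem isOrientation_extendOrientation {o : Fin 2 × Fin N → Label} :
    (E.diagram S D).IsOrientation (E.extendOrientation o) ↔ D.IsOrientation o := by
  constructor
  · rintro ⟨h₁, h₂⟩
    refine ⟨fun u v h => ?_, fun u v h => ?_⟩
    · simpa using h₁ _ _ ((E.isArc_vert hS D).2 h)
    · simpa using h₂ _ _ ((E.isSegment_vert hS D).2 h)
  · rintro ⟨h₁, h₂⟩
    refine ⟨fun u v h => ?_, fun u v h => ?_⟩
    · rcases E.isArc_cases hS D h with ⟨-, hu, hv⟩ | ⟨u, v, rfl, rfl⟩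
      · rw [E.extendOrientation_left _ _ hu, E.extendOrientation_right _ _ hv]
        simp
      · simpa using h₁ _ _ ((E.isArc_vert hS D).1 h)
    · rcases E.cover_vert u with hu | hu | ⟨u, rfl⟩
      · rw [E.extendOrientation_left _ _ hu, E.extendOrientation_left _ _ (h.2.2.1 ▸ hu)]
      · rw [E.extendOrientation_right _ _ hu, E.extendOrientation_right _ _ (h.2.2.1 ▸ hu)]
      · obtain ⟨v, rfl⟩ := E.mem_range_vert_of_eq h.2.2.1
        simpa using h₂ _ _ ((E.isSegment_vert hS D).1 h)

omit hS in
theorem diagram_cut_arc (hS : S ⊆ {E.newArc}) (p : Fin N × Fin N) :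
    (E.diagram S D).cut (E.arc p) = E.diagram S (D.cut p) := by
  have : (E.arcs S D.middle).erase (E.arc p) = E.arcs S (D.middle.erase p) := by
    ext q
    rw [Finset.mem_erase, E.mem_arcs, E.mem_arcs]
    constructor
    · rintro ⟨hne, h | ⟨r, hr, rfl⟩⟩
      · exact Or.inl h
      · exact Or.inr ⟨r, Finset.mem_erase.2 ⟨fun e => hne (congrArg E.arc e), hr⟩, rfl⟩
    · rintro (h | ⟨r, hr, rfl⟩)
      · refine ⟨?_, Or.inl h⟩
        rw [Finset.mem_singleton.1 (hS h)]
        exact (E.arc_ne_newArc p).symm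
      · rw [Finset.mem_erase] at hr
        exact ⟨fun e => hr.1 (E.arc_injective e), Or.inr ⟨r, hr.2, rfl⟩⟩
  simp only [StackedDiagram.cut, diagram, this]

/-- A surgery on an old pair of arcs does not see the inserted vertices. -/
theorem surgery_arc (p : Fin N × Fin N) (o o₁ : Fin 2 × Fin N → Label) :
    (E.diagram S D).Surgery (E.arc p) (E.extendOrientation o) (E.extendOrientation o₁) ↔
      D.Surgery p o o₁ := by
  have hv : ∀ (t : Fin 2) (i : Fin N), ((t, E.emb i) : Fin 2 × Fin M) = E.vert (t, i) :=
    fun _ _ => rfl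
  unfold StackedDiagram.Surgery
  rw [E.diagram_cut_arc D hS p]
  simp only [arc, hv, E.isOrientation_extendOrientation hS, E.sameComponent_vert hS,
    E.hasKind_vert hS, E.isPropagating_vert hS, E.strandLabel_vert hS]
  refine and_congr_right' (and_congr ?_ (and_congr_left' ?_))
  · constructor
    · intro h v h₁ h₂
      simpa using h (E.vert v) (fun h => h₁ ((E.sameComponent_vert hS D).1 h))
        (fun h => h₂ ((E.sameComponent_vert hS D).1 h))
    · intro h w h₁ h₂
      rcases E.cover_vert w with hw | hw | ⟨v, rfl⟩
      · rw [E.extendOrientation_left _ _ hw, E.extendOrientation_left _ _ hw]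
      · rw [E.extendOrientation_right _ _ hw, E.extendOrientation_right _ _ hw]
      · simpa using h v (fun h => h₁ ((E.sameComponent_vert hS D).2 h))
          (fun h => h₂ ((E.sameComponent_vert hS D).2 h))
  · constructor
    · intro h v hv
      simpa using h (E.vert v) (hv.imp (E.isBottomRay_vert D).2 (E.isTopRay_vert D).2)
    · intro h w hw
      obtain ⟨v, rfl⟩ := E.mem_range_of_isRay D hw
      simpa using h v (hw.imp (E.isBottomRay_vert D).1 (E.isTopRay_vert D).1)

/-- The new vertices are not on the components involved, and a surgery leaves the labels of all
other components as they are. -/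
theorem exists_eq_extendOrientation_of_surgery_arc {p : Fin N × Fin N}
    {o : Fin 2 × Fin N → Label} {o' : Fin 2 × Fin M → Label}
    (h : (E.diagram S D).Surgery (E.arc p) (E.extendOrientation o) o') :
    ∃ o₁, E.extendOrientation o₁ = o' := by
  have key : ∀ w : Fin 2 × Fin M, w.2 = E.left ∨ w.2 = E.right →
      o' w = E.extendOrientation o w := by
    intro w hw
    have no : ∀ v, ¬ (E.diagram S D).SameComponent (E.vert v) w := by
      intro v hvw
      obtain ⟨v', -, rfl⟩ := (E.sameComponent_vert_iff hS D).1 hvw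
      rcases hw with hw | hw
      exacts [E.emb_ne_left _ hw, E.emb_ne_right _ hw]
    exact h.2.1 w (no (0, p.1)) (no (1, p.1))
  exact ⟨_, (E.eq_extendOrientation
    (fun w hw => (key w (Or.inl hw)).trans (E.extendOrientation_left _ _ hw))
    (fun w hw => (key w (Or.inr hw)).trans (E.extendOrientation_right _ _ hw))).symm⟩

end Transfer

/-! ### The surgery on the inserted pair -/

theorem not_mem_range_of_sameComponent {S : Finset (Fin M × Fin M)} (hS : S ⊆ {E.newArc})
    (D : StackedDiagram N) {u w : Fin 2 × Fin M} (hu : u.2 = E.left ∨ u.2 = E.right)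
    (h : (E.diagram S D).SameComponent u w) : w.2 = E.left ∨ w.2 = E.right := by
  rcases E.cover_vert w with hw | hw | ⟨v, rfl⟩
  · exact Or.inl hw
  · exact Or.inr hw
  · obtain ⟨v', -, rfl⟩ := (E.sameComponent_vert_iff hS D).1 h.symm
    rcases hu with hu | hu
    exacts [absurd hu (E.emb_ne_left _), absurd hu (E.emb_ne_right _)]

theorem not_isStrand {S : Finset (Fin M × Fin M)} (hS : S ⊆ {E.newArc})
    (D : StackedDiagram N) {u : Fin 2 × Fin M} (hu : u.2 = E.left ∨ u.2 = E.right) :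
    ¬ (E.diagram S D).IsStrand u := by
  rintro ⟨w, hw, hr⟩
  obtain ⟨v, rfl⟩ := E.mem_range_of_isRay D hr
  rcases E.not_mem_range_of_sameComponent hS D hu hw with h | h
  exacts [E.emb_ne_left _ h, E.emb_ne_right _ h]

theorem left_le_of_sameComponent {S : Finset (Fin M × Fin M)} (hS : S ⊆ {E.newArc})
    (D : StackedDiagram N) {u w : Fin 2 × Fin M} (hu : u.2 = E.left ∨ u.2 = E.right)
    (h : (E.diagram S D).SameComponent u w) : E.left ≤ w.2 := by
  rcases E.not_mem_range_of_sameComponent hS D hu h with h | h <;> rw [h]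
  exact E.left_lt_right.le

/-- The two small circles are anti-clockwise. -/
theorem hasKind_one {S : Finset (Fin M × Fin M)} (hS : S ⊆ {E.newArc}) (D : StackedDiagram N)
    (o : Fin 2 × Fin N → Label) (t : Fin 2) :
    (E.diagram S D).HasKind (E.extendOrientation o) (t, E.left) Kind.one :=
  ⟨E.not_isStrand hS D (Or.inl rfl), (t, E.left), SimpleGraph.Reachable.refl _,
    fun _ h => E.left_le_of_sameComponent hS D (Or.inl rfl) h, E.extendOrientation_left _ _ rfl⟩

theorem isArc_left_right (S : Finset (Fin M × Fin M)) (D : StackedDiagram N) (t : Fin 2) :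
    (E.diagram S D).IsArc (t, E.left) (t, E.right) := by
  have h : ∀ C : Finset (Fin N × Fin N), (E.left, E.right) ∈ E.arcs {E.newArc} C :=
    fun C => E.mem_arcs.2 (Or.inl (Finset.mem_singleton_self _))
  fin_cases t
  exacts [Or.inl ⟨rfl, rfl, h _⟩, Or.inr (Or.inl ⟨rfl, rfl, h _⟩)]

theorem diagram_cut_newArc (D : StackedDiagram N) :
    (E.diagram {E.newArc} D).cut E.newArc = E.diagram ∅ D := by
  have : (E.arcs {E.newArc} D.middle).erase E.newArc = E.arcs ∅ D.middle := by
    ext q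
    simp only [Finset.mem_erase, E.mem_arcs, Finset.mem_singleton, Finset.notMem_empty, false_or]
    constructor
    · rintro ⟨hne, h | h⟩
      exacts [absurd h hne, h]
    · rintro ⟨r, hr, rfl⟩
      exact ⟨E.arc_ne_newArc r, Or.inr ⟨r, hr, rfl⟩⟩
  simp only [StackedDiagram.cut, diagram, this]

theorem isFree_arcs_empty_new (C : Finset (Fin N × Fin N)) {j : Fin M}
    (hj : j = E.left ∨ j = E.right) : IsFree (E.arcs ∅ C) j := by
  intro p hp
  obtain ⟨q, -, rfl⟩ := (E.mem_arcs.1 hp).resolve_left (Finset.notMem_empty _)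
  rcases hj with rfl | rfl
  exacts [⟨E.emb_ne_left _, E.emb_ne_left _⟩, ⟨E.emb_ne_right _, E.emb_ne_right _⟩]

/-- Before their surgery the new vertices carry no vertical segment, so the two small circles stay
on their own weight lines. They are thus distinct components, which rules out the splitting rule. -/
theorem fst_eq_of_sameComponent (D : StackedDiagram N) {u w : Fin 2 × Fin M}
    (hu : u.2 = E.left ∨ u.2 = E.right)
    (h : (E.diagram {E.newArc} D).SameComponent u w) : w.1 = u.1 := by
  rw [StackedDiagram.SameComponent, SimpleGraph.reachable_iff_reflTransGen] at h
  induction h with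
  | refl => rfl
  | @tail v w huv hadj ih =>
    have hv : v.2 = E.left ∨ v.2 = E.right := E.not_mem_range_of_sameComponent subset_rfl D hu
      ((SimpleGraph.reachable_iff_reflTransGen _ _).2 huv)
    have hw : w.2 = E.left ∨ w.2 = E.right :=
      E.not_mem_range_of_sameComponent subset_rfl D hv hadj.reachable
    have hf : ∀ j : Fin M, j = E.left ∨ j = E.right → ¬ IsFree (E.arcs {E.newArc} D.middle) j := by
      rintro j (rfl | rfl)
      exacts [E.not_isFree_left _, E.not_isFree_right _]
    rw [StackedDiagram.graph, SimpleGraph.fromRel_adj] at hadj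
    have harc : ∀ a b : Fin 2 × Fin M, (E.diagram {E.newArc} D).IsArc a b → a.1 = b.1 := by
      rintro a b (⟨h₁, h₂, -⟩ | ⟨h₁, h₂, -⟩ | ⟨h, -⟩)
      exacts [h₁.trans h₂.symm, h₁.trans h₂.symm, h]
    rcases hadj.2 with (h | h) | (h | h)
    · rw [← ih, harc _ _ h]
    · exact absurd h.2.2.2 (hf _ hv)
    · rw [← ih, harc _ _ h]
    · exact absurd h.2.2.2 (hf _ hw)

/-- The surgery on the inserted pair merges two anti-clockwise circles into an anti-clockwise
circle. -/
theorem surgery_newArc (D : StackedDiagram N) {o : Fin 2 × Fin N → Label}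
    (ho : D.IsOrientation o) (o' : Fin 2 × Fin M → Label) :
    (E.diagram {E.newArc} D).Surgery E.newArc (E.extendOrientation o) o' ↔
      o' = E.extendOrientation o := by
  have hne : ¬ (E.diagram {E.newArc} D).SameComponent (0, E.left) (1, E.left) := fun h => by
    have := E.fst_eq_of_sameComponent D (Or.inl rfl) h
    simp at this
  have hE : (∅ : Finset (Fin M × Fin M)) ⊆ {E.newArc} := Finset.empty_subset _
  unfold StackedDiagram.Surgery
  rw [E.diagram_cut_newArc]
  constructor
  · rintro ⟨hor, hcomp, -, ⟨h, -⟩ | ⟨-, s, s', t, hm, hs, hs', ht⟩ | ⟨-, hp, -⟩⟩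
    · exact absurd h hne
    -- The leftmost vertices of a small circle are at `E.left` and labelled `∨`, and the circle has
    -- no ray; so `one` is its only kind, and the only applicable merge is `1 ⊗ 1 ↦ 1`.
    · have one : ∀ {t : Fin 2} {s : Kind}, (E.diagram {E.newArc} D).HasKind
          (E.extendOrientation o) (t, E.left) s → s = Kind.one := by
        intro t s hs
        cases s with
        | one => rfl
        | x =>
          obtain ⟨-, w, hw, hmin, hl⟩ := hs
          have h₁ := hmin _ (SimpleGraph.Reachable.refl _)
          rcases E.not_mem_range_of_sameComponent subset_rfl D (Or.inl rfl) hw with h | h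
          · rw [E.extendOrientation_left _ _ h] at hl
            cases hl
          · rw [h] at h₁
            exact absurd E.left_lt_right h₁.not_gt
        | y => exact absurd hs (E.not_isStrand subset_rfl D (Or.inl rfl))
      obtain rfl := one (t := 0) hs
      obtain rfl := one (t := 1) hs'
      cases hm
      obtain ⟨-, w, hw, hmin, hl⟩ := ht
      have hw₂ : w.2 = E.left := by
        have h₁ := hmin _ (SimpleGraph.Reachable.refl _)
        rcases E.not_mem_range_of_sameComponent hE D (Or.inl rfl) hw with h | h
        · exact h
        · rw [h] at h₁
          exact absurd E.left_lt_right h₁.not_gt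
      -- The leftmost vertex `w` of the merged circle may be on either line; the vertical segment at
      -- `E.left` carries its label to the other line, and the outer arcs then fix the labels at
      -- `E.right`.
      have hseg : o' (0, E.left) = o' (1, E.left) :=
        hor.2 _ _ ⟨rfl, rfl, rfl, E.isFree_arcs_empty_new _ (Or.inl rfl)⟩
      have h0 : o' (0, E.left) = Label.down := by
        obtain ⟨t, j⟩ := w
        simp only at hw₂
        subst hw₂
        fin_cases t
        exacts [hl, hseg.trans hl]
      have hleft : ∀ t : Fin 2, o' (t, E.left) = Label.down := by
        intro t
        fin_cases t
        exacts [h0, hseg.symm.trans h0]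
      have hright : ∀ t : Fin 2, o' (t, E.right) = Label.up := by
        intro t
        have := hor.1 _ _ (E.isArc_left_right ∅ D t)
        rw [hleft t] at this
        cases h : o' (t, E.right) with
        | up => rfl
        | down => exact absurd h.symm this
      funext w
      obtain ⟨t, j⟩ := w
      rcases E.cover j with rfl | rfl | ⟨i, rfl⟩
      · rw [hleft, E.extendOrientation_left _ _ rfl]
      · rw [hright, E.extendOrientation_right _ _ rfl]
      · have no : ∀ t', ¬ (E.diagram {E.newArc} D).SameComponent (t', E.left) (t, E.emb i) := by
          intro t' h
          rcases E.not_mem_range_of_sameComponent subset_rfl D (Or.inl rfl) h with h | h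
          exacts [E.emb_ne_left _ h, E.emb_ne_right _ h]
        exact hcomp _ (no 0) (no 1)
    · obtain ⟨w, hw, hr⟩ := hp.1
      exact absurd ⟨w, hw, Or.inl hr⟩ (E.not_isStrand subset_rfl D (Or.inl rfl))
  · rintro rfl
    exact ⟨(E.isOrientation_extendOrientation hE D).2 ho, fun _ _ _ => rfl, fun _ _ => rfl,
      Or.inr (Or.inl ⟨hne, _, _, _, Merges.one_one, E.hasKind_one subset_rfl D o 0,
        E.hasKind_one subset_rfl D o 1, E.hasKind_one hE D o 0⟩)⟩

/-! ### Comparison of the coefficients -/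

open Classical in
-- Only labellings that extend one of the smaller diagram can result from the surgery, so the sum
-- reduces to these.
theorem sum_surgery_arc {S : Finset (Fin M × Fin M)} (hS : S ⊆ {E.newArc}) (D : StackedDiagram N)
    (p : Fin N × Fin N) (o : Fin 2 × Fin N → Label) (f : (Fin 2 × Fin M → Label) → ℕ) :
    (∑ o₁, if (E.diagram S D).Surgery (E.arc p) (E.extendOrientation o) o₁ then f o₁ else 0) =
      ∑ o₁, if D.Surgery p o o₁ then f (E.extendOrientation o₁) else 0 := by
  symm
  refine Fintype.sum_of_injective E.extendOrientation E.extendOrientation_injective _ _ ?_ ?_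
  · intro o' ho'
    rw [if_neg]
    exact fun h => ho' (E.exists_eq_extendOrientation_of_surgery_arc hS D h)
  · intro o₁
    simp only [E.surgery_arc hS]

theorem surgeryCoeff_map {S : Finset (Fin M × Fin M)} (hS : S ⊆ {E.newArc})
    (ps : List (Fin N × Fin N)) (D : StackedDiagram N) (o o' : Fin 2 × Fin N → Label) :
    StackedDiagram.surgeryCoeff (ps.map E.arc) (E.diagram S D) (E.extendOrientation o)
      (E.extendOrientation o') = StackedDiagram.surgeryCoeff ps D o o' := by
  induction ps generalizing D o with
  | nil =>
    simp only [List.map_nil, StackedDiagram.surgeryCoeff, E.extendOrientation_injective.eq_iff]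
  | cons p ps ih =>
    simp only [List.map_cons, StackedDiagram.surgeryCoeff, E.sum_surgery_arc hS,
      E.diagram_cut_arc D hS, ih]

theorem surgeryCoeff_map_eq_zero {S : Finset (Fin M × Fin M)} (hS : S ⊆ {E.newArc})
    (ps : List (Fin N × Fin N)) (D : StackedDiagram N) (o : Fin 2 × Fin N → Label)
    {o' : Fin 2 × Fin M → Label} (ho' : o' ∉ Set.range E.extendOrientation) :
    StackedDiagram.surgeryCoeff (ps.map E.arc) (E.diagram S D) (E.extendOrientation o) o' = 0 := by
  induction ps generalizing D o with
  | nil =>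
    rw [List.map_nil, StackedDiagram.surgeryCoeff, if_neg]
    exact fun h => ho' ⟨o, h⟩
  | cons p ps ih =>
    simp only [List.map_cons, StackedDiagram.surgeryCoeff, E.sum_surgery_arc hS,
      E.diagram_cut_arc D hS, ih, ite_self, Finset.sum_const_zero]

theorem surgeryCoeff_newArc_cons (ps : List (Fin M × Fin M)) (D : StackedDiagram N)
    {o : Fin 2 × Fin N → Label} (ho : D.IsOrientation o) (o' : Fin 2 × Fin M → Label) :
    StackedDiagram.surgeryCoeff (E.newArc :: ps) (E.diagram {E.newArc} D)
      (E.extendOrientation o) o' =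
        StackedDiagram.surgeryCoeff ps (E.diagram ∅ D) (E.extendOrientation o) o' := by
  simp only [StackedDiagram.surgeryCoeff, E.surgery_newArc D ho, E.diagram_cut_newArc,
    Finset.sum_ite_eq', Finset.mem_univ, if_true]

/-- The old pairs in `l₁` are treated while the small circles are separate, those in `l₂` after they
have been merged. -/
theorem surgeryCoeff_insert (l₁ l₂ : List (Fin N × Fin N)) (D : StackedDiagram N)
    {o : Fin 2 × Fin N → Label} (ho : D.IsOrientation o) (o' : Fin 2 × Fin N → Label) :
    StackedDiagram.surgeryCoeff (l₁.map E.arc ++ E.newArc :: l₂.map E.arc)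
      (E.diagram {E.newArc} D) (E.extendOrientation o) (E.extendOrientation o') =
        StackedDiagram.surgeryCoeff (l₁ ++ l₂) D o o' := by
  induction l₁ generalizing D o with
  | nil =>
    rw [List.map_nil, List.nil_append, E.surgeryCoeff_newArc_cons _ D ho,
      E.surgeryCoeff_map (Finset.empty_subset _), List.nil_append]
  | cons p l₁ ih =>
    simp only [List.map_cons, List.cons_append, StackedDiagram.surgeryCoeff,
      E.sum_surgery_arc subset_rfl, E.diagram_cut_arc D subset_rfl]
    refine Finset.sum_congr rfl fun o₁ _ => ?_
    split_ifs with h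
    -- The first clause of `Surgery` supplies the orientation hypothesis for the remaining list.
    exacts [ih _ h.1, rfl]

theorem surgeryCoeff_insert_eq_zero (l₁ l₂ : List (Fin N × Fin N)) (D : StackedDiagram N)
    {o : Fin 2 × Fin N → Label} (ho : D.IsOrientation o) {o' : Fin 2 × Fin M → Label}
    (ho' : o' ∉ Set.range E.extendOrientation) :
    StackedDiagram.surgeryCoeff (l₁.map E.arc ++ E.newArc :: l₂.map E.arc)
      (E.diagram {E.newArc} D) (E.extendOrientation o) o' = 0 := by
  induction l₁ generalizing D o with
  | nil =>
    rw [List.map_nil, List.nil_append, E.surgeryCoeff_newArc_cons _ D ho,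
      E.surgeryCoeff_map_eq_zero (Finset.empty_subset _) _ _ _ ho']
  | cons p l₁ ih =>
    simp only [List.map_cons, List.cons_append, StackedDiagram.surgeryCoeff,
      E.sum_surgery_arc subset_rfl, E.diagram_cut_arc D subset_rfl]
    refine Finset.sum_eq_zero fun o₁ _ => ?_
    split_ifs with h
    exacts [ih _ h.1, rfl]

end Insertion

/-! ### Rays of oriented diagrams -/

/-- Each cup has exactly one end labelled `∧` by `a`, and distinct cups have no common end. -/
theorem card_up_not_isFree {N : ℕ} {u a : Fin N → Label} (ha : Oriented u a) :
    (Finset.univ.filter fun i => ¬ IsFree (cups u) i ∧ a i = Label.up).card = (cups u).card := by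
  classical
  have hC := isCupDiagram_cups u
  have key : (Finset.univ.filter fun i => ¬ IsFree (cups u) i ∧ a i = Label.up) =
      (cups u).image fun p => if a p.1 = Label.up then p.1 else p.2 := by
    ext i
    simp only [Finset.mem_filter, Finset.mem_univ, true_and, Finset.mem_image, not_isFree_iff]
    constructor
    · rintro ⟨⟨p, hp, rfl | rfl⟩, hi⟩
      · exact ⟨p, hp, if_pos hi⟩
      · exact ⟨p, hp, if_neg fun h => ha.1 p hp (h.trans hi.symm)⟩
    · rintro ⟨p, hp, rfl⟩
      split_ifs with h
      · exact ⟨⟨p, hp, Or.inl rfl⟩, h⟩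
      · refine ⟨⟨p, hp, Or.inr rfl⟩, ?_⟩
        have := ha.1 p hp
        cases h₁ : a p.1 <;> cases h₂ : a p.2 <;> simp_all
  rw [key, Finset.card_image_of_injOn]
  intro p hp q hq hpq
  have no : ∀ p ∈ cups u, ∀ q ∈ cups u, p.1 ≠ q.2 := by
    intro p hp q hq h
    have h₁ := hC.down p hp
    rw [h, hC.up q hq] at h₁
    cases h₁
  simp only at hpq
  split_ifs at hpq
  · exact hC.eq_of_left p hp q hq hpq
  · exact absurd hpq (no p hp q hq)
  · exact absurd hpq.symm (no q hq p hp)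
  · exact hC.eq_of_right p hp q hq hpq

theorem card_up_isFree {N : ℕ} {u a : Fin N → Label} (ha : Oriented u a) :
    (Finset.univ.filter fun i => IsFree (cups u) i ∧ a i = Label.up).card + (cups u).card =
      (Finset.univ.filter fun i => a i = Label.up).card := by
  rw [← card_up_not_isFree ha, ← Finset.card_union_of_disjoint]
  · congr 1
    ext i
    simp only [Finset.mem_union, Finset.mem_filter, Finset.mem_univ, true_and]
    tauto
  · rw [Finset.disjoint_left]
    intro i h₁ h₂
    exact (Finset.mem_filter.1 h₂).2.1 (Finset.mem_filter.1 h₁).2.1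

/-- If `a` has `∧` and `b` has `∨` at the ray `i`, then `b` has no `∧` at a ray right of `i`, while
`a` has `∧` at all rays left of `i`. So the `∧`-rays of `b` form a proper subset of those of `a`,
although `card_up_isFree` makes their numbers equal. -/
theorem Oriented.not_up_down_of_isFree {N : ℕ} {u a b : Fin N → Label} (ha : Oriented u a)
    (hb : Oriented u b) (hab : (Finset.univ.filter fun i => a i = Label.up).card =
      (Finset.univ.filter fun i => b i = Label.up).card) {i : Fin N} (hi : IsFree (cups u) i) :
    ¬ (a i = Label.up ∧ b i = Label.down) := by
  rintro ⟨hai, hbi⟩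
  have hss : (Finset.univ.filter fun j => IsFree (cups u) j ∧ b j = Label.up) ⊂
      Finset.univ.filter fun j => IsFree (cups u) j ∧ a j = Label.up := by
    rw [Finset.ssubset_iff_of_subset]
    · exact ⟨i, by simp [hi, hai], by simp [hbi]⟩
    · intro j hj
      obtain ⟨hj, hbj⟩ := (Finset.mem_filter.1 hj).2
      refine Finset.mem_filter.2 ⟨Finset.mem_univ _, hj, ?_⟩
      rcases lt_trichotomy j i with h | h | h
      · cases haj : a j with
        | up => rfl
        | down => exact absurd ⟨haj, hai⟩ (ha.2 j i h hj hi)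
      · rw [h, hai]
      · exact absurd ⟨hbi, hbj⟩ (hb.2 i j h hi hj)
  have h₁ := Finset.card_lt_card hss
  have h₂ := card_up_isFree ha
  have h₃ := card_up_isFree hb
  omega

/-- Two weights that orient the same cup diagram agree at its rays. -/
theorem Oriented.eq_of_isFree {N : ℕ} {u a b : Fin N → Label} (ha : Oriented u a)
    (hb : Oriented u b) (hab : (Finset.univ.filter fun i => a i = Label.up).card =
      (Finset.univ.filter fun i => b i = Label.up).card) {i : Fin N} (hi : IsFree (cups u) i) :
    a i = b i := by
  have h₁ := ha.not_up_down_of_isFree hb hab hi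
  have h₂ := hb.not_up_down_of_isFree ha hab.symm hi
  cases h : a i <;> cases h' : b i <;> simp_all

/-! ### The list of arcs -/

@[simp]
theorem mem_cupList {N : ℕ} {a : Fin N → Label} {p : Fin N × Fin N} :
    p ∈ cupList a ↔ p ∈ cups a := by
  rw [cupList, List.mem_filter, decide_eq_true_iff, and_iff_right]
  exact List.mem_product.2 ⟨List.mem_finRange _, List.mem_finRange _⟩

theorem pairwise_cupList {N : ℕ} (a : Fin N → Label) :
    (cupList a).Pairwise fun p q => toLex p < toLex q := by
  refine List.Pairwise.filter _ ?_
  change List.Pairwise _ ((List.finRange N).flatMap fun i => (List.finRange N).map (Prod.mk i))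
  rw [List.pairwise_flatMap]
  constructor
  · intro i _
    rw [List.pairwise_map]
    refine (List.pairwise_lt_finRange N).imp fun h => ?_
    exact Prod.Lex.toLex_lt_toLex.2 (Or.inr ⟨rfl, h⟩)
  · refine (List.pairwise_lt_finRange N).imp fun h => ?_
    intro p hp q hq
    obtain ⟨_, -, rfl⟩ := List.mem_map.1 hp
    obtain ⟨_, -, rfl⟩ := List.mem_map.1 hq
    exact Prod.Lex.toLex_lt_toLex.2 (Or.inl h)

theorem eq_of_pairwise_toLex_lt {N : ℕ} {l l' : List (Fin N × Fin N)}
    (hl : l.Pairwise fun p q => toLex p < toLex q) (hl' : l'.Pairwise fun p q => toLex p < toLex q)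
    (h : ∀ p, p ∈ l ↔ p ∈ l') : l = l' := by
  refine List.Perm.eq_of_pairwise (fun p q _ _ h₁ h₂ => absurd h₁ h₂.not_gt) hl hl' ?_
  rw [List.perm_ext_iff_of_nodup]
  · exact h
  · exact hl.imp fun h e => h.ne (congrArg toLex e)
  · exact hl'.imp fun h e => h.ne (congrArg toLex e)

namespace Insertion

variable {N M : ℕ} {E : Insertion N M}

/-- Both lists are in strict lexicographic order, and `E.arc` preserves this order. A strictly
sorted list is determined by its members, so removing the new arc from the larger list leaves the
image of the smaller one. -/
theorem Extends.exists_cupList_eq {a : Fin N → Label} {a' : Fin M → Label}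
    (h : E.Extends a a') : ∃ l₁ l₂, cupList a = l₁ ++ l₂ ∧
      cupList a' = l₁.map E.arc ++ E.newArc :: l₂.map E.arc := by
  have hnew : E.newArc ∈ cupList a' := by
    rw [mem_cupList, h.cups_eq, E.mem_arcs]
    exact Or.inl (Finset.mem_singleton_self _)
  obtain ⟨s, t, hst⟩ := List.append_of_mem hnew
  have hpw := pairwise_cupList a'
  have hmem : ∀ p, p ∈ cupList a' ↔ p = E.newArc ∨ p ∈ (cupList a).map E.arc := by
    intro p
    rw [mem_cupList, h.cups_eq, E.mem_arcs, Finset.mem_singleton, List.mem_map]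
    simp only [mem_cupList]
  rw [hst] at hpw hmem
  have hnot : E.newArc ∉ s ++ t := by
    have hnd : (s ++ E.newArc :: t).Nodup := hpw.imp fun h e => h.ne (congrArg toLex e)
    exact (List.nodup_cons.1 (List.nodup_middle.1 hnd)).1
  have hmap : (cupList a).map E.arc = s ++ t := by
    refine eq_of_pairwise_toLex_lt ?_ ?_ ?_
    · rw [List.pairwise_map]
      refine (pairwise_cupList a).imp fun {p q} h => ?_
      rw [Prod.Lex.toLex_lt_toLex] at h ⊢
      exact h.imp (fun h => E.strictMono h)
        fun h => ⟨congrArg E.emb h.1, E.strictMono h.2⟩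
    · exact hpw.sublist (List.Sublist.append_left (List.sublist_cons_self _ _) _)
    · intro p
      have h₁ := hmem p
      by_cases hp : p = E.newArc
      · subst hp
        refine iff_of_false ?_ hnot
        rw [List.mem_map]
        rintro ⟨q, -, hq⟩
        exact E.arc_ne_newArc q hq
      · simp only [List.mem_append, List.mem_cons, hp, false_or] at h₁ ⊢
        exact h₁.symm
  obtain ⟨l₁, l₂, h₁, rfl, rfl⟩ := List.map_eq_append_iff.1 hmap
  exact ⟨l₁, l₂, h₁, hst⟩

theorem Extends.card_up {a : Fin N → Label} {a' : Fin M → Label} (h : E.Extends a a') :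
    (Finset.univ.filter fun j => a' j = Label.up).card =
      (Finset.univ.filter fun i => a i = Label.up).card + 1 := by
  have key : (Finset.univ.filter fun j => a' j = Label.up) =
      insert E.right ((Finset.univ.filter fun i => a i = Label.up).image E.emb) := by
    ext j
    simp only [Finset.mem_filter, Finset.mem_univ, true_and, Finset.mem_insert, Finset.mem_image]
    rcases E.cover j with rfl | rfl | ⟨i, rfl⟩
    · simp [h.left, E.left_ne_right, E.emb_ne_left]
    · simp [h.right]
    · simp [h.emb, E.emb_ne_right, E.strictMono.injective.eq_iff]
  rw [key, Finset.card_insert_of_notMem, Finset.card_image_of_injective _ E.strictMono.injective]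
  simp [E.emb_ne_right]

end Insertion

/-! ### Dilation as an insertion -/

section Dilation

variable {m n : ℕ} (k : ℤ) (hk : -(m : ℤ) ≤ k) (hk' : k ≤ (n : ℤ))

/-- The insertion of the vertices `k - 1/2` and `k + 1/2`. -/
def dilationInsertion : Insertion (m + n) ((m + 1) + (n + 1)) where
  emb i := if ((i : ℕ) : ℤ) < k + m then ⟨i, by omega⟩ else ⟨i + 2, by omega⟩
  left := ⟨(k + m).toNat, by omega⟩
  right := ⟨(k + m).toNat + 1, by omega⟩
  strictMono := by
    intro i j hij
    dsimp only
    split_ifs <;> simp only [Fin.mk_lt_mk] <;> omega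
  right_eq := rfl
  emb_ne_left := by
    intro i
    split_ifs <;> simp only [ne_eq, Fin.mk.injEq] <;> omega
  emb_ne_right := by
    intro i
    split_ifs <;> simp only [ne_eq, Fin.mk.injEq] <;> omega
  cover := by
    intro j
    by_cases h₁ : ((j : ℕ) : ℤ) < k + m
    · exact Or.inr (Or.inr ⟨⟨j, by omega⟩, by simp [h₁]⟩)
    by_cases h₂ : ((j : ℕ) : ℤ) = k + m
    · exact Or.inl (Fin.ext (by dsimp only; omega))
    by_cases h₃ : ((j : ℕ) : ℤ) = k + m + 1
    · exact Or.inr (Or.inl (Fin.ext (by dsimp only; omega)))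
    refine Or.inr (Or.inr ⟨⟨j - 2, by omega⟩, ?_⟩)
    rw [if_neg (by dsimp only; omega)]
    exact Fin.ext (by dsimp only; omega)

theorem extends_dilateLabels (a : Fin (m + n) → Label) :
    (dilationInsertion k hk hk').Extends a (dilateLabels k hk hk' a) where
  emb i := by
    simp only [dilationInsertion]
    by_cases h : ((i : ℕ) : ℤ) < k + m
    · rw [if_pos h, dilateLabels, dif_pos h]
    · rw [if_neg h, dilateLabels, dif_neg, dif_neg, dif_neg]
      · rfl
      all_goals dsimp only; omega
  left := by
    rw [dilateLabels, dif_neg, dif_pos] <;> dsimp only [dilationInsertion] <;> omega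
  right := by
    rw [dilateLabels, dif_neg, dif_neg, dif_pos] <;> dsimp only [dilationInsertion] <;> omega

theorem extends_dilate (a : Weight m n) :
    (dilationInsertion k hk hk').Extends a.1 (dilate k hk hk' a).1 :=
  extends_dilateLabels k hk hk' a.1

theorem dilate_injective : Function.Injective (dilate (m := m) (n := n) k hk hk') := by
  intro a b h
  apply Subtype.ext
  funext i
  rw [← (extends_dilate k hk hk' a).emb, h, (extends_dilate k hk hk' b).emb]

/-- Deleting a `∨ ∧` pair at the new vertices removes exactly one `∧`, so what remains is again a
weight, now with `m` labels `∧`. -/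
theorem mem_range_dilate {a' : Weight (m + 1) (n + 1)}
    (hl : a'.1 (dilationInsertion k hk hk').left = Label.down)
    (hr : a'.1 (dilationInsertion k hk hk').right = Label.up) :
    a' ∈ Set.range (dilate (m := m) (n := n) k hk hk') := by
  have hE : (dilationInsertion k hk hk').Extends
      (fun i => a'.1 ((dilationInsertion k hk hk').emb i)) a'.1 := ⟨fun _ => rfl, hl, hr⟩
  have hc := hE.card_up
  rw [a'.2] at hc
  refine ⟨⟨_, (Nat.succ.inj hc).symm⟩, Subtype.ext (funext fun j => ?_)⟩
  have hd := extends_dilate k hk hk' ⟨_, (Nat.succ.inj hc).symm⟩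
  rcases (dilationInsertion k hk hk').cover j with rfl | rfl | ⟨i, rfl⟩
  · rw [hd.left, hl]
  · rw [hd.right, hr]
  · rw [hd.emb]

/-- The dilation map on arc diagrams. -/
def ArcDiagram.dilate (d : ArcDiagram m n) : ArcDiagram (m + 1) (n + 1) where
  bot := ArcAlgebra.dilate k hk hk' d.bot
  wt := ArcAlgebra.dilate k hk hk' d.wt
  top := ArcAlgebra.dilate k hk hk' d.top
  oriented_bot :=
    ((extends_dilate k hk hk' d.bot).oriented_iff (extends_dilate k hk hk' d.wt)).2 d.oriented_bot
  oriented_top :=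
    ((extends_dilate k hk hk' d.top).oriented_iff (extends_dilate k hk hk' d.wt)).2 d.oriented_top

theorem ArcDiagram.dilate_injective :
    Function.Injective (ArcDiagram.dilate (m := m) (n := n) k hk hk') := by
  intro d d' h
  have h₁ := congrArg ArcDiagram.bot h
  have h₂ := congrArg ArcDiagram.wt h
  have h₃ := congrArg ArcDiagram.top h
  exact ArcDiagram.ext (ArcAlgebra.dilate_injective k hk hk' h₁)
    (ArcAlgebra.dilate_injective k hk hk' h₂) (ArcAlgebra.dilate_injective k hk hk' h₃)

theorem ArcDiagram.degree_dilate (d : ArcDiagram m n) :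
    (d.dilate k hk hk').degree = d.degree := by
  have hw := extends_dilate k hk hk' d.wt
  exact congrArg₂ (· + ·) ((extends_dilate k hk hk' d.bot).clockwiseCount_eq hw)
    ((extends_dilate k hk hk' d.top).clockwiseCount_eq hw)

end Dilation

/-! ### Structure constants -/

/-- The stacked diagram in which `d` is placed under `d'`. -/
def ArcDiagram.stack {m n : ℕ} (d d' : ArcDiagram m n) : StackedDiagram (m + n) :=
  { lower := cups d.bot.1, middle := cups d.top.1, upper := cups d'.top.1 }

/-- The labelling of the two weight lines of `d.stack d'`. -/
def ArcDiagram.stackLabels {m n : ℕ} (d d' : ArcDiagram m n) (v : Fin 2 × Fin (m + n)) : Label :=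
  if v.1 = 0 then d.wt.1 v.2 else d'.wt.1 v.2

/-- The coefficient of the weight `a` in the product of two arc diagrams. -/
noncomputable def ArcDiagram.mulCoeff {m n : ℕ} (d d' : ArcDiagram m n) (a : Weight m n) : ℕ :=
  StackedDiagram.surgeryCoeff (cupList d.top.1) (d.stack d') (d.stackLabels d') fun v => a.1 v.2

theorem ArcDiagram.isOrientation_stackLabels {m n : ℕ} {d d' : ArcDiagram m n}
    (h : d.top = d'.bot) : (d.stack d').IsOrientation (d.stackLabels d') := by
  have hd' : Oriented d.top.1 d'.wt.1 := h ▸ d'.oriented_bot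
  constructor
  · rintro ⟨s, i⟩ ⟨t, j⟩ (⟨hs, ht, hp⟩ | ⟨hs, ht, hp⟩ | ⟨hst, hp⟩)
    · simp only at hs ht
      subst hs ht
      exact d.oriented_bot.1 _ hp
    · simp only at hs ht
      subst hs ht
      exact d'.oriented_top.1 _ hp
    · simp only at hst
      subst hst
      fin_cases s
      exacts [d.oriented_top.1 _ hp, hd'.1 _ hp]
  · rintro ⟨s, i⟩ ⟨t, j⟩ ⟨hs, ht, hij, hf⟩
    simp only at hs ht hij
    subst hs ht hij
    -- A vertical segment of the initial stack consists of two glued rays; both weights orient the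
    -- cup diagram of `d.top` and have `m` labels `∧`, so they agree there.
    exact d.oriented_top.eq_of_isFree hd' (d.wt.2.trans d'.wt.2.symm) hf

section Dilation

variable {m n : ℕ} (k : ℤ) (hk : -(m : ℤ) ≤ k) (hk' : k ≤ (n : ℤ))

theorem ArcDiagram.stack_dilate (d d' : ArcDiagram m n) :
    (d.dilate k hk hk').stack (d'.dilate k hk hk') = (dilationInsertion k hk hk').diagram
      {(dilationInsertion k hk hk').newArc} (d.stack d') := by
  have h := fun a : Weight m n => (extends_dilate k hk hk' a).cups_eq
  simp only [ArcDiagram.stack, ArcDiagram.dilate, h, Insertion.diagram]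

theorem extendOrientation_eq_of_extends {N M : ℕ} {E : Insertion N M}
    {o : Fin 2 × Fin N → Label} {o' : Fin 2 × Fin M → Label}
    (h : ∀ t, E.Extends (fun i => o (t, i)) fun j => o' (t, j)) :
    o' = E.extendOrientation o := by
  rw [E.eq_extendOrientation (o' := o')]
  · exact congrArg _ (funext fun v => (h v.1).emb v.2)
  · rintro ⟨t, j⟩ rfl
    exact (h t).left
  · rintro ⟨t, j⟩ rfl
    exact (h t).right

theorem ArcDiagram.stackLabels_dilate (d d' : ArcDiagram m n) :
    (d.dilate k hk hk').stackLabels (d'.dilate k hk hk') =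
      (dilationInsertion k hk hk').extendOrientation (d.stackLabels d') := by
  refine extendOrientation_eq_of_extends fun t => ?_
  fin_cases t
  exacts [extends_dilate k hk hk' d.wt, extends_dilate k hk hk' d'.wt]

theorem ArcDiagram.mulCoeff_dilate {d d' : ArcDiagram m n} (h : d.top = d'.bot)
    (a : Weight m n) :
    (d.dilate k hk hk').mulCoeff (d'.dilate k hk hk') (ArcAlgebra.dilate k hk hk' a) =
      d.mulCoeff d' a := by
  obtain ⟨l₁, l₂, hl, hl'⟩ := (extends_dilate k hk hk' d.top).exists_cupList_eq
  have ha : (fun v : Fin 2 × Fin ((m + 1) + (n + 1)) => (ArcAlgebra.dilate k hk hk' a).1 v.2) =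
      (dilationInsertion k hk hk').extendOrientation fun v => a.1 v.2 :=
    extendOrientation_eq_of_extends fun _ => extends_dilate k hk hk' a
  rw [mulCoeff, ArcDiagram.stack_dilate, ArcDiagram.stackLabels_dilate, ha]
  change StackedDiagram.surgeryCoeff (cupList (ArcAlgebra.dilate k hk hk' d.top).1) _ _ _ = _
  rw [hl', Insertion.surgeryCoeff_insert _ _ _ _ (isOrientation_stackLabels h), mulCoeff, hl]

theorem ArcDiagram.mulCoeff_dilate_eq_zero {d d' : ArcDiagram m n} (h : d.top = d'.bot)
    {a' : Weight (m + 1) (n + 1)}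
    (ha' : a' ∉ Set.range (ArcAlgebra.dilate (m := m) (n := n) k hk hk')) :
    (d.dilate k hk hk').mulCoeff (d'.dilate k hk hk') a' = 0 := by
  obtain ⟨l₁, l₂, hl, hl'⟩ := (extends_dilate k hk hk' d.top).exists_cupList_eq
  rw [mulCoeff, ArcDiagram.stack_dilate, ArcDiagram.stackLabels_dilate]
  change StackedDiagram.surgeryCoeff (cupList (ArcAlgebra.dilate k hk hk' d.top).1) _ _ _ = _
  rw [hl', Insertion.surgeryCoeff_insert_eq_zero _ _ _ _ (isOrientation_stackLabels h)]
  -- The final labelling is `a'` on both lines, so reading off the new vertices of one line shows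
  -- that `a'` is a dilated weight.
  rintro ⟨o, ho⟩
  refine ha' (mem_range_dilate k hk hk' ?_ ?_)
  · have := congrFun ho (0, (dilationInsertion k hk hk').left)
    rw [Insertion.extendOrientation_left _ _ _ rfl] at this
    exact this.symm
  · have := congrFun ho (0, (dilationInsertion k hk hk').right)
    rw [Insertion.extendOrientation_right _ _ _ rfl] at this
    exact this.symm

end Dilation

/-! ### The dilation homomorphism on the algebra -/

namespace KhovanovArcAlgebra

variable (R : Type*) [CommRing R] {m n : ℕ}

theorem diagramMul_of_eq {d d' : ArcDiagram m n} (h : d.top = d'.bot) :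
    diagramMul R d d' = ∑ a : Weight m n,
      if h : Oriented d.bot.1 a.1 ∧ Oriented d'.top.1 a.1 then
        (d.mulCoeff d' a : R) • ofDiagram R ⟨d.bot, a, d'.top, h.1, h.2⟩
      else 0 :=
  if_pos h

variable {R} in
theorem induction_on {P : KhovanovArcAlgebra R m n → Prop} (f : KhovanovArcAlgebra R m n)
    (zero : P 0) (add : ∀ f g, P f → P g → P (f + g))
    (smul : ∀ (r : R) d, P (r • ofDiagram R d)) : P f := by
  refine Finsupp.induction_linear (motive := P) f zero add fun d r => ?_
  have : r • ofDiagram R d = (Finsupp.single d r : ArcDiagram m n →₀ R) := by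
    rw [ofDiagram]
    exact (Finsupp.smul_single r d 1).trans (by rw [smul_eq_mul, mul_one])
  rw [← this]
  exact smul r d

variable (k : ℤ) (hk : -(m : ℤ) ≤ k) (hk' : k ≤ (n : ℤ))

/-- The linear extension of the dilation map on arc diagrams. -/
noncomputable def dilateLinear :
    KhovanovArcAlgebra R m n →ₗ[R] KhovanovArcAlgebra R (m + 1) (n + 1) :=
  (Finsupp.lmapDomain R R (ArcDiagram.dilate k hk hk') :
    (ArcDiagram m n →₀ R) →ₗ[R] (ArcDiagram (m + 1) (n + 1) →₀ R))

theorem dilateLinear_ofDiagram (d : ArcDiagram m n) :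
    dilateLinear R k hk hk' (ofDiagram R d) = ofDiagram R (d.dilate k hk hk') :=
  Finsupp.mapDomain_single

theorem dilateLinear_injective : Function.Injective (dilateLinear R (m := m) k hk hk') :=
  Finsupp.mapDomain_injective (ArcDiagram.dilate_injective k hk hk')

theorem dilateLinear_diagramMul (d d' : ArcDiagram m n) :
    dilateLinear R k hk hk' (diagramMul R d d') =
      diagramMul R (d.dilate k hk hk') (d'.dilate k hk hk') := by
  by_cases h : d.top = d'.bot
  · have h' : (d.dilate k hk hk').top = (d'.dilate k hk hk').bot := congrArg (dilate k hk hk') h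
    rw [diagramMul_of_eq R h, diagramMul_of_eq R h', map_sum]
    -- The product upstairs runs over all larger weights; those that are not dilated contribute
    -- zero, and the others match the terms downstairs one by one.
    refine Fintype.sum_of_injective _ (dilate_injective k hk hk') _ _ ?_ ?_
    · intro a' ha'
      split_ifs with ho
      · rw [ArcDiagram.mulCoeff_dilate_eq_zero k hk hk' h ha', Nat.cast_zero, zero_smul]
      · rfl
    · intro a
      have hiff : (Oriented (d.dilate k hk hk').bot.1 (dilate k hk hk' a).1 ∧
          Oriented (d'.dilate k hk hk').top.1 (dilate k hk hk' a).1) ↔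
          (Oriented d.bot.1 a.1 ∧ Oriented d'.top.1 a.1) :=
        and_congr ((extends_dilate k hk hk' d.bot).oriented_iff (extends_dilate k hk hk' a))
          ((extends_dilate k hk hk' d'.top).oriented_iff (extends_dilate k hk hk' a))
      by_cases ho : Oriented d.bot.1 a.1 ∧ Oriented d'.top.1 a.1
      · rw [dif_pos ho, dif_pos (hiff.2 ho), map_smul, dilateLinear_ofDiagram,
          ArcDiagram.mulCoeff_dilate k hk hk' h]
        rfl
      · rw [dif_neg ho, dif_neg fun h => ho (hiff.1 h), map_zero]
  -- Injectivity of dilation on weights ensures that a product that vanishes for lack of matching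
  -- middle weights also vanishes after dilation.
  · have h' : (d.dilate k hk hk').top ≠ (d'.dilate k hk hk').bot :=
      fun e => h (dilate_injective k hk hk' e)
    rw [diagramMul, if_neg h, diagramMul, if_neg h', map_zero]

theorem dilateLinear_mul (f g : KhovanovArcAlgebra R m n) :
    dilateLinear R k hk hk' (f * g) = dilateLinear R k hk hk' f * dilateLinear R k hk hk' g := by
  induction f using induction_on with
  | zero => rw [zero_mul, map_zero, zero_mul]
  | add f₁ f₂ h₁ h₂ => rw [add_mul, map_add, h₁, h₂, map_add, add_mul]
  | smul r d =>
    induction g using induction_on with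
    | zero => rw [mul_zero, map_zero, mul_zero]
    | add g₁ g₂ h₁ h₂ => rw [mul_add, map_add, h₁, h₂, map_add, mul_add]
    | smul s d' =>
      simp only [smul_mul_assoc, mul_smul_comm, map_smul, ofDiagram_mul_ofDiagram,
        dilateLinear_diagramMul, dilateLinear_ofDiagram]

/-- The dilation homomorphism of extended Khovanov arc algebras. -/
noncomputable def dilateHom :
    KhovanovArcAlgebra R m n →ₙₐ[R] KhovanovArcAlgebra R (m + 1) (n + 1) :=
  { dilateLinear R k hk hk' with
    map_smul' := (dilateLinear R k hk hk').map_smul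
    map_zero' := (dilateLinear R k hk hk').map_zero
    map_mul' := dilateLinear_mul R k hk hk' }

theorem dilateLinear_mem_gradedPiece {e : ℕ} {f : KhovanovArcAlgebra R m n}
    (hf : f ∈ gradedPiece R m n e) :
    dilateLinear R k hk hk' f ∈ gradedPiece R (m + 1) (n + 1) e := by
  refine Submodule.span_le (p := (gradedPiece R (m + 1) (n + 1) e).comap
    (dilateLinear R k hk hk')).2 ?_ hf
  rintro _ ⟨d, hd, rfl⟩
  refine Submodule.subset_span ⟨d.dilate k hk hk', ?_, dilateLinear_ofDiagram R k hk hk' d⟩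
  rw [ArcDiagram.degree_dilate, hd]

end KhovanovArcAlgebra

end ArcAlgebra

theorem mainTheorem6 {R : Type*} [CommRing R] [IsDomain R] (m n : ℕ) (k : ℤ)
    (hk : -(m : ℤ) ≤ k) (hk' : k ≤ (n : ℤ)) :
    ∃ Φ : ArcAlgebra.KhovanovArcAlgebra R m n →ₙₐ[R]
        ArcAlgebra.KhovanovArcAlgebra R (m + 1) (n + 1),
      (∀ d : ArcAlgebra.ArcDiagram m n, ∃ d' : ArcAlgebra.ArcDiagram (m + 1) (n + 1),
        d'.bot = ArcAlgebra.dilate k hk hk' d.bot ∧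
        d'.wt = ArcAlgebra.dilate k hk hk' d.wt ∧
        d'.top = ArcAlgebra.dilate k hk hk' d.top ∧
        Φ (ArcAlgebra.KhovanovArcAlgebra.ofDiagram R d) =
          ArcAlgebra.KhovanovArcAlgebra.ofDiagram R d') ∧
      Function.Injective Φ ∧
      ∀ e : ℕ, ∀ f ∈ ArcAlgebra.KhovanovArcAlgebra.gradedPiece R m n e,
        Φ f ∈ ArcAlgebra.KhovanovArcAlgebra.gradedPiece R (m + 1) (n + 1) e :=
  ⟨ArcAlgebra.KhovanovArcAlgebra.dilateHom R k hk hk',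
    fun d => ⟨d.dilate k hk hk', rfl, rfl, rfl,
      ArcAlgebra.KhovanovArcAlgebra.dilateLinear_ofDiagram R k hk hk' d⟩,
    ArcAlgebra.KhovanovArcAlgebra.dilateLinear_injective R k hk hk',
    fun _ _ hf => ArcAlgebra.KhovanovArcAlgebra.dilateLinear_mem_gradedPiece R k hk hk' hf⟩
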